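/- Let $L>0$, let $\mathbb T^2=\mathbb R^2/(2L\mathbb Z)^2$ carry the normalised Lebesgue measure $\nu_2=(2L)^{-2}m_2$, and let $L^p(\mathbb T^2)=L^p(\mathbb T^2,\nu_2)$ (complex-valued functions). For $k,l\in\mathbb Z$ and $\varepsilon\in[0,1]$ put $$e_{k,l}(x,y)=\tfrac1{2L}e^{-i\pi(kx+ly)/L},\qquad \lambda_{k,l,\varepsilon}=-\Big\{\big(1-(\tfrac{\pi}{L})^2k^2\big)^2+(\tfrac{\pi}{L})^2l^2-\varepsilon^2\Big\},$$ so that $e_{k,l}$ is an eigenfunction of $\mathcal L_\varepsilon=-(1+\partial_x^2)^2+\partial_y^2+\varepsilon^2$ with eigenvalue $\lambda_{k,l,\varepsilon}$. For $s\in\mathbb R$ and $1\le p<\infty$ let $\mathcal W^{s,p}(\mathbb T^2)$ be the space of periodic distributions $f$ with $(1-\mathcal L_0)^{s/2}f\in L^p(\mathbb T^2)$, with norm $\|f\|_{\mathcal W^{s,p}}=\|(1-\mathcal L_0)^{s/2}f\|_{L^p}$, where $(1-\mathcal L_0)^{s/2}$ multiplies the Fourier coefficient of index $(k,l)$ by $(1-\lambda_{k,l,0})^{s/2}$.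 Let $(\beta_{k,l})_{k,l\in\mathbb Z}$ be independent standard real Brownian motions on a probability space $(\Omega,\mathcal F,\mathbb P)$, let $\xi=\sum_{k,l}\beta_{k,l}e_{k,l}$ be the associated cylindrical Wiener process on $L^2(\mathbb T^2)$, and for $t\ge0$ let $$Z(t)=\int_0^te^{(t-u)\mathcal L_1}\,d\xi(u)=\sum_{k,l\in\mathbb Z}\Big(\int_0^te^{(t-u)\lambda_{k,l,1}}\,d\beta_{k,l}(u)\Big)e_{k,l},$$ with Wiener integrals in the sum. To obtain instead a real-valued noise, one may replace the $e_{k,l}$ in the formulas for $\xi$ and $Z$ by the real eigenfunctions $\sqrt2\,\mathrm{Re}\,e_{k,l}$ (if $k>0$ or $k=0<l$), $e_{0,0}$, and $\sqrt2\,\mathrm{Im}\,e_{k,l}$ (otherwise); the following holds in both cases. **Theorem.** Let $T>0$ and $1\le p<\infty$. The series defining $Z(t)$ converges in $L^2(\Omega;L^2(\mathbb T^2))$ for every $t\in[0,T]$. There is a constant $M_{p,T,L}>0$, depending only on $p$, $T$ and $L$, such that for all $s\in[0,\frac18)$ and $\alpha\in(0,\frac18-s)$ the process $(Z(t))_{t\in[0,T]}$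 has a modification, again denoted by $Z$, all of whose paths lie in $C^\alpha([0,T];\mathcal W^{s,p}(\mathbb T^2))$, that is, $$\sup_{t,t'\in[0,T],\,t\ne t'}\frac{\|Z(t)-Z(t')\|_{\mathcal W^{s,p}}}{|t-t'|^\alpha}<\infty ,$$ and that satisfies $$\mathbb E\Big(\sup_{t\in[0,T]}\|Z(t)\|_{L^p(\mathbb T^2)}\Big)\le M_{p,T,L}.$$ -/

import Mathlib

open MeasureTheory ProbabilityTheory Filter Topology Set
open scoped NNReal ENNReal

noncomputable section

namespace SwiftHohenberg

/-! ### The torus, the operators and their eigenfunctions -/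

/-- The torus `𝕋² = ℝ² / (2Lℤ)²`. -/
abbrev Torus (L : ℝ) : Type := AddCircle (2 * L) × AddCircle (2 * L)

/-- The normalised Lebesgue measure `ν₂ = (2L)⁻² m₂` on `𝕋²`. -/
def torusMeasure (L : ℝ) [Fact (0 < 2 * L)] : Measure (Torus L) :=
  (AddCircle.haarAddCircle (T := 2 * L)).prod (AddCircle.haarAddCircle (T := 2 * L))

instance (L : ℝ) [Fact (0 < 2 * L)] : IsProbabilityMeasure (torusMeasure L) := by
  unfold torusMeasure; infer_instance

/-- The eigenvalue `λ_{k,l,ε} = -((1 - (π/L)² k²)² + (π/L)² l² - ε²)` of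
`𝓛_ε = -(1 + ∂ₓ²)² + ∂_y² + ε²`. -/
def eigenvalue (L ε : ℝ) (j : ℤ × ℤ) : ℝ :=
  -((1 - (Real.pi / L) ^ 2 * (j.1 : ℝ) ^ 2) ^ 2 + (Real.pi / L) ^ 2 * (j.2 : ℝ) ^ 2 - ε ^ 2)

/-- The eigenfunction `e_{k,l}(x,y) = (2L)⁻¹ exp(-iπ(kx + ly)/L)`; here
`fourier n x = exp(2πi n x / (2L))` on `ℝ / 2Lℤ`. -/
def expMode (L : ℝ) (j : ℤ × ℤ) : C(Torus L, ℂ) where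
  toFun z := ((2 * L : ℝ) : ℂ)⁻¹ * (fourier (-j.1) z.1 * fourier (-j.2) z.2)
  continuous_toFun := by fun_prop

/-- The real trigonometric eigenfunctions with the same eigenvalues and the same `L²`-norms:
`√2 Re e_{k,l}` (a cosine) on the half of `ℤ² \ {0}` where `k > 0` or `k = 0 < l`, the constant
`e_{0,0}`, and `√2 Im e_{k,l}` (a sine) on the other half. -/
def trigMode (L : ℝ) (j : ℤ × ℤ) : C(Torus L, ℂ) where
  toFun z :=
    if j = 0 then expMode L j z
    else if 0 < j.1 ∨ (j.1 = 0 ∧ 0 < j.2) then ((Real.sqrt 2 * (expMode L j z).re : ℝ) : ℂ)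
    else ((Real.sqrt 2 * (expMode L j z).im : ℝ) : ℂ)
  continuous_toFun := by
    split_ifs <;> fun_prop

/-- The coefficient `(f, e_{k,l}) = ∫ f \overline{e_{k,l}} dν₂`. -/
def coeff (L : ℝ) [Fact (0 < 2 * L)] (f : Torus L → ℂ) (j : ℤ × ℤ) : ℂ :=
  ∫ z, f z * (starRingEnd ℂ) (expMode L j z) ∂(torusMeasure L)

/-! ### Periodic distributions -/

/-- Periodic distributions on `𝕋²`, each given by the family of its Fourier coefficients
`(f, e_{k,l})`; these are exactly the families of at most polynomial growth. -/
def PeriodicDistribution : Submodule ℂ (ℤ × ℤ → ℂ) where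
  carrier := {a | ∃ (C : ℝ) (N : ℕ), ∀ j, ‖a j‖ ≤ C * (1 + |(j.1 : ℝ)| + |(j.2 : ℝ)|) ^ N}
  zero_mem' := ⟨0, 0, fun j => by simp⟩
  add_mem' := by
    rintro a b ⟨C, N, h⟩ ⟨D, M, h'⟩
    refine ⟨|C| + |D|, N + M, fun j => ?_⟩
    have hx : 1 ≤ 1 + |(j.1 : ℝ)| + |(j.2 : ℝ)| := by
      have := abs_nonneg (j.1 : ℝ); have := abs_nonneg (j.2 : ℝ); linarith
    set x := 1 + |(j.1 : ℝ)| + |(j.2 : ℝ)|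
    have h1 : x ^ N ≤ x ^ (N + M) := pow_le_pow_right₀ hx (by omega)
    have h2 : x ^ M ≤ x ^ (N + M) := pow_le_pow_right₀ hx (by omega)
    have hN : 0 ≤ x ^ N := by positivity
    have hM : 0 ≤ x ^ M := by positivity
    calc ‖a j + b j‖ ≤ ‖a j‖ + ‖b j‖ := norm_add_le _ _
      _ ≤ C * x ^ N + D * x ^ M := add_le_add (h j) (h' j)
      _ ≤ |C| * x ^ N + |D| * x ^ M := by
          gcongr
          · exact le_abs_self C
          · exact le_abs_self D
      _ ≤ |C| * x ^ (N + M) + |D| * x ^ (N + M) := by gcongr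
      _ = (|C| + |D|) * x ^ (N + M) := by ring
  smul_mem' := by
    rintro c a ⟨C, N, h⟩
    refine ⟨‖c‖ * C, N, fun j => ?_⟩
    rw [Pi.smul_apply, norm_smul, mul_assoc]
    exact mul_le_mul_of_nonneg_left (h j) (norm_nonneg _)

/-- `1 - λ_{k,l} ≥ 1`, where `λ_{k,l} = λ_{k,l,0}`. -/
theorem one_le_one_sub_eigenvalue (L : ℝ) (j : ℤ × ℤ) : 1 ≤ 1 - eigenvalue L 0 j := by
  unfold eigenvalue
  have h1 := sq_nonneg (1 - (Real.pi / L) ^ 2 * (j.1 : ℝ) ^ 2)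
  have h2 : 0 ≤ (Real.pi / L) ^ 2 * (j.2 : ℝ) ^ 2 := by positivity
  linarith

theorem one_sub_eigenvalue_le (L : ℝ) : ∃ C : ℝ, 1 ≤ C ∧ ∀ j : ℤ × ℤ,
    1 - eigenvalue L 0 j ≤ C * (1 + |(j.1 : ℝ)| + |(j.2 : ℝ)|) ^ 4 := by
  set b := (Real.pi / L) ^ 2 with hb
  have hb0 : 0 ≤ b := by positivity
  refine ⟨2 + b ^ 2 + b, by nlinarith, fun j => ?_⟩
  unfold eigenvalue
  rw [← hb]
  set u := |(j.1 : ℝ)| with hu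
  set v := |(j.2 : ℝ)| with hv
  have hu0 : 0 ≤ u := abs_nonneg _
  have hv0 : 0 ≤ v := abs_nonneg _
  rw [← sq_abs (j.1 : ℝ), ← sq_abs (j.2 : ℝ), ← hu, ← hv]
  have hx : 1 ≤ 1 + u + v := by linarith
  have h1 : u ^ 4 ≤ (1 + u + v) ^ 4 := pow_le_pow_left₀ hu0 (by linarith) 4
  have h2 : v ^ 2 ≤ (1 + u + v) ^ 4 :=
    (pow_le_pow_left₀ hv0 (by linarith) 2).trans (pow_le_pow_right₀ hx (by norm_num))
  have h3 : 1 ≤ (1 + u + v) ^ 4 := one_le_pow₀ hx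
  have h4 : 0 ≤ b * u ^ 2 := by positivity
  have h5 : b ^ 2 * u ^ 4 ≤ b ^ 2 * (1 + u + v) ^ 4 := by gcongr
  have h6 : b * v ^ 2 ≤ b * (1 + u + v) ^ 4 := by gcongr
  nlinarith

/-- The operator `(1 - 𝓛₀)^{s/2}` on periodic distributions, `s ∈ ℝ`. -/
def besselPotential (L s : ℝ) : PeriodicDistribution →ₗ[ℂ] PeriodicDistribution where
  toFun f := ⟨fun j => (((1 - eigenvalue L 0 j) ^ (s / 2) : ℝ) : ℂ) * (f : ℤ × ℤ → ℂ) j, by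
    obtain ⟨f, C, N, h⟩ := f
    obtain ⟨D, hD, hD'⟩ := one_sub_eigenvalue_le L
    obtain ⟨n, hn⟩ := exists_nat_ge (s / 2)
    refine ⟨D ^ n * |C|, 4 * n + N, fun j => ?_⟩
    have h1 := one_le_one_sub_eigenvalue L j
    have hx0 : 0 ≤ 1 + |(j.1 : ℝ)| + |(j.2 : ℝ)| := by positivity
    have h2 : (1 - eigenvalue L 0 j) ^ (s / 2) ≤
        D ^ n * (1 + |(j.1 : ℝ)| + |(j.2 : ℝ)|) ^ (4 * n) := by
      calc (1 - eigenvalue L 0 j) ^ (s / 2) ≤ (1 - eigenvalue L 0 j) ^ (n : ℝ) :=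
            Real.rpow_le_rpow_of_exponent_le h1 hn
        _ = (1 - eigenvalue L 0 j) ^ n := Real.rpow_natCast _ _
        _ ≤ (D * (1 + |(j.1 : ℝ)| + |(j.2 : ℝ)|) ^ 4) ^ n :=
            pow_le_pow_left₀ (by linarith) (hD' j) n
        _ = _ := by rw [mul_pow, ← pow_mul]
    have h3 : ‖f j‖ ≤ |C| * (1 + |(j.1 : ℝ)| + |(j.2 : ℝ)|) ^ N :=
      (h j).trans (mul_le_mul_of_nonneg_right (le_abs_self C) (by positivity))
    have h4 : 0 ≤ (1 - eigenvalue L 0 j) ^ (s / 2) := Real.rpow_nonneg (by linarith) _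
    rw [norm_mul, Complex.norm_real, Real.norm_eq_abs, abs_of_nonneg h4]
    calc _ ≤ (D ^ n * (1 + |(j.1 : ℝ)| + |(j.2 : ℝ)|) ^ (4 * n)) *
          (|C| * (1 + |(j.1 : ℝ)| + |(j.2 : ℝ)|) ^ N) :=
          mul_le_mul h2 h3 (norm_nonneg _) (h4.trans h2)
      _ = _ := by rw [pow_add]; ring⟩
  map_add' f g := by
    ext j
    simp [mul_add]
  map_smul' c f := by
    ext j
    simp [mul_left_comm]

theorem besselPotential_injective (L s : ℝ) : Function.Injective (besselPotential L s) := by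
  intro f g h
  ext j
  have h1 := one_le_one_sub_eigenvalue L j
  have h2 : 0 < (1 - eigenvalue L 0 j) ^ (s / 2) := Real.rpow_pos_of_pos (by linarith) _
  have h3 := congrFun (congrArg Subtype.val h) j
  exact mul_left_cancel₀ (Complex.ofReal_ne_zero.mpr h2.ne') h3

/-! ### Functions as distributions -/

section Embedding

variable (L : ℝ) [Fact (0 < 2 * L)]

theorem norm_expMode (j : ℤ × ℤ) (z : Torus L) : ‖expMode L j z‖ = (2 * L)⁻¹ := by
  have hL : 0 < 2 * L := Fact.out
  have h : ‖((2 * L : ℝ) : ℂ)⁻¹‖ = (2 * L)⁻¹ := by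
    rw [norm_inv, Complex.norm_real, Real.norm_eq_abs, abs_of_pos hL]
  rw [expMode, ContinuousMap.coe_mk, norm_mul, h, norm_mul, fourier_apply, fourier_apply,
    Circle.norm_coe, Circle.norm_coe, mul_one, mul_one]

theorem integrable_mul_conj_expMode {f : Torus L → ℂ} (hf : Integrable f (torusMeasure L))
    (j : ℤ × ℤ) :
    Integrable (fun z => f z * (starRingEnd ℂ) (expMode L j z)) (torusMeasure L) := by
  refine hf.mul_bdd (c := (2 * L)⁻¹) ?_ ?_
  · exact (Complex.continuous_conj.comp (expMode L j).continuous).aestronglyMeasurable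
  · exact Eventually.of_forall fun z => by
      rw [RCLike.norm_conj, norm_expMode]

/-- The embedding of `L^p(𝕋²)`, `p ∈ [1,∞]`, into the periodic distributions. -/
def lpToDistribution (p : ℝ≥0∞) [Fact (1 ≤ p)] :
    Lp ℂ p (torusMeasure L) →ₗ[ℂ] PeriodicDistribution where
  toFun f := ⟨coeff L f, by
    have hf : Integrable f (torusMeasure L) := (Lp.memLp f).integrable Fact.out
    refine ⟨(∫ z, ‖f z‖ ∂(torusMeasure L)) * (2 * L)⁻¹, 0, fun j => ?_⟩
    rw [pow_zero, mul_one, ← integral_mul_const]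
    refine (norm_integral_le_integral_norm _).trans_eq (integral_congr_ae ?_)
    exact Eventually.of_forall fun z => by
      simp only [norm_mul, RCLike.norm_conj, norm_expMode]⟩
  map_add' f g := by
    ext j
    have hf : Integrable f (torusMeasure L) := (Lp.memLp f).integrable Fact.out
    have hg : Integrable g (torusMeasure L) := (Lp.memLp g).integrable Fact.out
    change coeff L _ j = coeff L f j + coeff L g j
    unfold coeff
    rw [← integral_add (integrable_mul_conj_expMode L hf j) (integrable_mul_conj_expMode L hg j)]
    refine integral_congr_ae ?_
    filter_upwards [Lp.coeFn_add f g] with z hz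
    rw [hz, Pi.add_apply, add_mul]
  map_smul' c f := by
    ext j
    change coeff L _ j = c * coeff L f j
    unfold coeff
    rw [← integral_const_mul]
    refine integral_congr_ae ?_
    filter_upwards [Lp.coeFn_smul c f] with z hz
    rw [hz, Pi.smul_apply, smul_eq_mul, mul_assoc]

/-- The star subalgebra of `C(𝕋², ℂ)` generated by the exponentials. -/
def expSubalgebra : StarSubalgebra ℂ C(Torus L, ℂ) where
  toSubalgebra := Algebra.adjoin ℂ (range (expMode L))
  star_mem' := by
    change Algebra.adjoin ℂ (range (expMode L)) ≤ star (Algebra.adjoin ℂ (range (expMode L)))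
    refine Algebra.adjoin_le ?_
    rintro _ ⟨j, rfl⟩
    refine Algebra.subset_adjoin ⟨-j, ?_⟩
    ext z
    simp [expMode, fourier_apply]

theorem expMode_mul (i j : ℤ × ℤ) :
    expMode L i * expMode L j = ((2 * L : ℝ) : ℂ)⁻¹ • expMode L (i + j) := by
  ext z
  simp only [expMode, ContinuousMap.mul_apply, ContinuousMap.coe_mk, ContinuousMap.smul_apply,
    smul_eq_mul, Prod.fst_add, Prod.snd_add, neg_add, fourier_add]
  ring

theorem expMode_zero : expMode L 0 = ((2 * L : ℝ) : ℂ)⁻¹ • (1 : C(Torus L, ℂ)) := by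
  ext z
  simp [expMode]

theorem expSubalgebra_coe :
    Subalgebra.toSubmodule (expSubalgebra L).toSubalgebra =
      Submodule.span ℂ (range (expMode L)) := by
  have hL : ((2 * L : ℝ) : ℂ) ≠ 0 := Complex.ofReal_ne_zero.mpr (Fact.out : 0 < 2 * L).ne'
  refine Algebra.adjoin_eq_span_of_subset (R := ℂ) (s := range (expMode L)) ?_
  intro x hx
  refine Submonoid.closure_induction (fun y hy => Submodule.subset_span hy) ?_ ?_ hx
  · have : (1 : C(Torus L, ℂ)) = ((2 * L : ℝ) : ℂ) • expMode L 0 := by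
      rw [expMode_zero, smul_smul, mul_inv_cancel₀ hL, one_smul]
    rw [this]
    exact Submodule.smul_mem _ _ (Submodule.subset_span ⟨0, rfl⟩)
  · intro a b _ _ ha hb
    have := Submodule.mul_mem_mul ha hb
    rw [Submodule.span_mul_span] at this
    refine Submodule.span_le.mpr ?_ this
    rintro _ ⟨_, ⟨i, rfl⟩, _, ⟨j, rfl⟩, rfl⟩
    change expMode L i * expMode L j ∈ _
    rw [expMode_mul]
    exact Submodule.smul_mem _ _ (Submodule.subset_span ⟨_, rfl⟩)

theorem expSubalgebra_separatesPoints : (expSubalgebra L).SeparatesPoints := by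
  have hL : (2 * L) ≠ 0 := (Fact.out : 0 < 2 * L).ne'
  have hL' : ((2 * L : ℝ) : ℂ)⁻¹ ≠ 0 := inv_ne_zero (Complex.ofReal_ne_zero.mpr hL)
  intro x y hxy
  rw [Ne, Prod.ext_iff, not_and_or] at hxy
  rcases hxy with h | h
  · refine ⟨_, ⟨expMode L (-1, 0), Algebra.subset_adjoin ⟨_, rfl⟩, rfl⟩, ?_⟩
    contrapose h
    have h' := mul_left_cancel₀ hL' h
    simp only [neg_neg, neg_zero, fourier_zero, mul_one, fourier_one] at h'
    exact AddCircle.injective_toCircle hL (Circle.ext h')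
  · refine ⟨_, ⟨expMode L (0, -1), Algebra.subset_adjoin ⟨_, rfl⟩, rfl⟩, ?_⟩
    contrapose h
    have h' := mul_left_cancel₀ hL' h
    simp only [neg_neg, neg_zero, fourier_zero, one_mul, fourier_one] at h'
    exact AddCircle.injective_toCircle hL (Circle.ext h')

theorem span_expMode_closure_eq_top :
    (Submodule.span ℂ (range (expMode L))).topologicalClosure = ⊤ := by
  rw [← expSubalgebra_coe]
  exact congrArg (Subalgebra.toSubmodule <| StarSubalgebra.toSubalgebra ·)
    (ContinuousMap.starSubalgebra_topologicalClosure_eq_top_of_separatesPoints _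
      (expSubalgebra_separatesPoints L))

theorem integral_mul_eq_zero_of_coeff_eq_zero {f : Torus L → ℂ}
    (hf : Integrable f (torusMeasure L)) (h : ∀ j, coeff L f j = 0) (φ : C(Torus L, ℂ)) :
    ∫ z, f z * φ z ∂(torusMeasure L) = 0 := by
  have hint : ∀ φ : C(Torus L, ℂ), Integrable (fun z => f z * φ z) (torusMeasure L) := fun φ =>
    hf.mul_bdd (c := ‖φ‖) φ.continuous.aestronglyMeasurable
      (Eventually.of_forall fun z => φ.norm_coe_le_norm z)
  let T : C(Torus L, ℂ) →ₗ[ℂ] ℂ :=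
    { toFun := fun φ => ∫ z, f z * φ z ∂(torusMeasure L)
      map_add' := fun φ ψ => by
        rw [← integral_add (hint φ) (hint ψ)]
        simp [mul_add]
      map_smul' := fun c φ => by
        rw [RingHom.id_apply, smul_eq_mul, ← integral_const_mul]
        simp [mul_left_comm] }
  let T' : C(Torus L, ℂ) →L[ℂ] ℂ := T.mkContinuous (∫ z, ‖f z‖ ∂(torusMeasure L)) fun φ => by
    rw [← integral_mul_const]
    refine (norm_integral_le_integral_norm _).trans ?_
    refine integral_mono (hint φ).norm (hf.norm.mul_const _) fun z => ?_
    simp only [norm_mul]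
    exact mul_le_mul_of_nonneg_left (φ.norm_coe_le_norm z) (norm_nonneg _)
  have hker : Submodule.span ℂ (range (expMode L)) ≤ LinearMap.ker T'.toLinearMap := by
    refine Submodule.span_le.mpr ?_
    rintro _ ⟨j, rfl⟩
    change ∫ z, f z * expMode L j z ∂(torusMeasure L) = 0
    have := h (-j)
    unfold coeff at this
    rw [← this]
    refine integral_congr_ae (Eventually.of_forall fun z => ?_)
    simp only [expMode, ContinuousMap.coe_mk, map_mul, map_inv₀, Complex.conj_ofReal,
      Prod.fst_neg, Prod.snd_neg, neg_neg, fourier_neg]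
  have hcl : (Submodule.span ℂ (range (expMode L))).topologicalClosure ≤
      LinearMap.ker T'.toLinearMap :=
    Submodule.topologicalClosure_minimal _ hker T'.isClosed_ker
  rw [span_expMode_closure_eq_top] at hcl
  exact hcl (Submodule.mem_top (x := φ))

/-- An integrable function on `𝕋²` whose Fourier coefficients all vanish is zero. -/
theorem ae_eq_zero_of_coeff_eq_zero {f : Torus L → ℂ}
    (hf : Integrable f (torusMeasure L)) (h : ∀ j, coeff L f j = 0) :
    f =ᵐ[torusMeasure L] 0 := by
  refine ae_eq_zero_of_forall_setIntegral_isClosed_eq_zero hf fun s hs => ?_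
  have hδ : ∀ n : ℕ, (0 : ℝ) < 1 / ((n : ℝ) + 1) := fun n => Nat.one_div_pos_of_nat
  have hlim := tendsto_one_div_add_atTop_nhds_zero_nat (𝕜 := ℝ)
  have hpt := thickenedIndicator_tendsto_indicator_closure hδ hlim s
  rw [tendsto_pi_nhds] at hpt
  have hφ : ∀ n, Continuous fun z => (((thickenedIndicator (hδ n) s z : ℝ≥0) : ℝ) : ℂ) :=
    fun n => Complex.continuous_ofReal.comp
      (NNReal.continuous_coe.comp (thickenedIndicator (hδ n) s).continuous)
  have h0 : ∀ n, ∫ z, f z * (((thickenedIndicator (hδ n) s z : ℝ≥0) : ℝ) : ℂ)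
      ∂(torusMeasure L) = 0 := fun n =>
    integral_mul_eq_zero_of_coeff_eq_zero L hf h ⟨_, hφ n⟩
  have hT : Tendsto (fun n : ℕ => ∫ z, f z * (((thickenedIndicator (hδ n) s z : ℝ≥0) : ℝ) : ℂ)
      ∂(torusMeasure L)) atTop (𝓝 (∫ z, s.indicator f z ∂(torusMeasure L))) := by
    refine tendsto_integral_of_dominated_convergence (fun z => ‖f z‖) (fun n => ?_) hf.norm
      (fun n => ?_) ?_
    · exact hf.aestronglyMeasurable.mul (hφ n).aestronglyMeasurable
    · refine Eventually.of_forall fun z => ?_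
      rw [norm_mul, Complex.norm_real, Real.norm_eq_abs, NNReal.abs_eq]
      exact mul_le_of_le_one_right (norm_nonneg _)
        (by exact_mod_cast thickenedIndicator_le_one (hδ n) s z)
    · refine Eventually.of_forall fun z => ?_
      have h1 := hpt z
      have h2 : Tendsto (fun n => f z * (((thickenedIndicator (hδ n) s z : ℝ≥0) : ℝ) : ℂ)) atTop
          (𝓝 (f z * ((((closure s).indicator (fun _ => (1 : ℝ≥0)) z : ℝ≥0) : ℝ) : ℂ))) :=
        ((((Complex.continuous_ofReal.comp NNReal.continuous_coe).tendsto _).comp h1)).const_mul _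
      convert h2 using 2
      rw [hs.closure_eq]
      by_cases hz : z ∈ s <;> simp [hz]
  simp only [h0] at hT
  rw [← integral_indicator hs.measurableSet]
  exact tendsto_nhds_unique hT tendsto_const_nhds |>.symm ▸ rfl

theorem lpToDistribution_injective (p : ℝ≥0∞) [Fact (1 ≤ p)] :
    Function.Injective (lpToDistribution L p) := by
  rw [← LinearMap.ker_eq_bot, LinearMap.ker_eq_bot']
  intro f hf
  have hint : Integrable f (torusMeasure L) := (Lp.memLp f).integrable Fact.out
  have := ae_eq_zero_of_coeff_eq_zero L hint fun j => congrFun (congrArg Subtype.val hf) j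
  exact (Lp.eq_zero_iff_ae_eq_zero).mpr this

/-! ### The spaces `𝒲^{s,p}(𝕋²)` -/

/-- The set of periodic distributions `f` with `(1 - 𝓛₀)^{s/2} f ∈ L^p(𝕋²)`. -/
def sobolevSubmodule (s : ℝ) (p : ℝ≥0∞) [Fact (1 ≤ p)] : Submodule ℂ PeriodicDistribution :=
  (LinearMap.range (lpToDistribution L p)).comap (besselPotential L s)

/-- The space `𝒲^{s,p}(𝕋²)`. -/
def Sobolev (s : ℝ) (p : ℝ≥0∞) [Fact (1 ≤ p)] : Type := sobolevSubmodule L s p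

namespace Sobolev

variable (s : ℝ) (p : ℝ≥0∞) [Fact (1 ≤ p)]

instance : AddCommGroup (Sobolev L s p) :=
  inferInstanceAs (AddCommGroup (sobolevSubmodule L s p))

instance : Module ℂ (Sobolev L s p) :=
  inferInstanceAs (Module ℂ (sobolevSubmodule L s p))

/-- The distribution underlying an element of `𝒲^{s,p}(𝕋²)`. -/
def toDistribution : Sobolev L s p →ₗ[ℂ] PeriodicDistribution :=
  (sobolevSubmodule L s p).subtype

/-- The map `f ↦ (1 - 𝓛₀)^{s/2} f` from `𝒲^{s,p}(𝕋²)` to `L^p(𝕋²)`. -/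
def toLp : Sobolev L s p →ₗ[ℂ] Lp ℂ p (torusMeasure L) :=
  (LinearEquiv.ofInjective (lpToDistribution L p)
    (lpToDistribution_injective L p)).symm.toLinearMap ∘ₗ
    (((besselPotential L s) ∘ₗ toDistribution L s p).codRestrict
      (LinearMap.range (lpToDistribution L p)) fun f => f.2)

theorem toDistribution_toLp (f : Sobolev L s p) :
    lpToDistribution L p (toLp L s p f) = besselPotential L s (toDistribution L s p f) :=
  congrArg Subtype.val ((LinearEquiv.ofInjective (lpToDistribution L p)
    (lpToDistribution_injective L p)).apply_symm_apply _)

theorem toLp_injective : Function.Injective (toLp L s p) := by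
  intro f g h
  have h1 := congrArg (lpToDistribution L p) h
  rw [toDistribution_toLp, toDistribution_toLp] at h1
  exact Subtype.val_injective (besselPotential_injective L s h1)

/-- `‖f‖_{𝒲^{s,p}} = ‖(1 - 𝓛₀)^{s/2} f‖_{L^p}`. -/
instance : NormedAddCommGroup (Sobolev L s p) :=
  NormedAddCommGroup.induced (Sobolev L s p) (Lp ℂ p (torusMeasure L)) (toLp L s p)
    (toLp_injective L s p)

instance : NormedSpace ℂ (Sobolev L s p) :=
  NormedSpace.induced ℂ (Sobolev L s p) (Lp ℂ p (torusMeasure L)) (toLp L s p)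

end Sobolev

/-- The `L^p`-norm of a periodic distribution: `‖g‖_{L^p}` if it is given by a (then unique)
`g ∈ L^p(𝕋²)`, and `∞` otherwise. -/
def distLpNorm (p : ℝ≥0∞) [Fact (1 ≤ p)] (f : PeriodicDistribution) : ℝ≥0∞ :=
  ⨅ (g : Lp ℂ p (torusMeasure L)) (_ : lpToDistribution L p g = f), ‖g‖ₑ

end Embedding

/-! ### Wiener integrals and the stochastic convolution -/

/-- The step function `∑_{i<n} c_i 1_{(τ_i, τ_{i+1}]}`. -/
def stepFunction (n : ℕ) (τ : ℕ → ℝ≥0) (c : ℕ → ℝ) (u : ℝ) : ℝ :=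
  ∑ i ∈ Finset.range n, (Ioc (τ i : ℝ) (τ (i + 1) : ℝ)).indicator (fun _ => c i) u

/-- The integral `∑_{i<n} c_i (B(τ_{i+1}) - B(τ_i))` of the step function. -/
def stepIntegral {Ω : Type*} (B : ℝ≥0 → Ω → ℝ) (n : ℕ) (τ : ℕ → ℝ≥0) (c : ℕ → ℝ) (ω : Ω) : ℝ :=
  ∑ i ∈ Finset.range n, c i * (B (τ (i + 1)) ω - B (τ i) ω)

/-- `I = ∫_0^t f dB` for a deterministic `f ∈ L²(0,t)` and a Brownian motion `B`: for some step
functions on `(0,t]` that converge to `f` in `L²(0,t)`, their integrals converge to `I` in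
`L²(Ω)`. By the Itô isometry this determines `I` almost surely. -/
def IsWienerIntegral {Ω : Type*} [MeasurableSpace Ω] (P : Measure Ω) (B : ℝ≥0 → Ω → ℝ) (t : ℝ≥0)
    (f : ℝ → ℝ) (I : Ω → ℝ) : Prop :=
  MemLp f 2 (volume.restrict (Ioc (0 : ℝ) t)) ∧ AEStronglyMeasurable I P ∧
  ∃ (n : ℕ → ℕ) (τ : ℕ → ℕ → ℝ≥0) (c : ℕ → ℕ → ℝ),
    (∀ m, Monotone (τ m)) ∧ (∀ m i, τ m i ≤ t) ∧
    Tendsto (fun m => eLpNorm (fun u => f u - stepFunction (n m) (τ m) (c m) u) 2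
      (volume.restrict (Ioc (0 : ℝ) t))) atTop (𝓝 0) ∧
    Tendsto (fun m => eLpNorm (fun ω => I ω - stepIntegral B (n m) (τ m) (c m) ω) 2 P)
      atTop (𝓝 0)

/-- `β` is a family of independent standard real Brownian motions. -/
structure IsIndepBrownianFamily {Ω : Type*} [MeasurableSpace Ω] (P : Measure Ω)
    (β : ℤ × ℤ → ℝ≥0 → Ω → ℝ) : Prop where
  measurable : ∀ j t, Measurable (β j t)
  brownian : ∀ j, IsBrownianReal (β j) P
  indep : iIndepFun (fun j ω t => β j t ω) P

/-- `Z(t) = ∫_0^t e^{(t-u)𝓛₁} dξ(u) = ∑_{k,l} (∫_0^t e^{(t-u)λ_{k,l,1}} dβ_{k,l}(u)) e_{k,l}` for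
`t ∈ [0,T]`, where `ξ = ∑_{k,l} β_{k,l} e_{k,l}` and the series converges in `L²(Ω; L²(𝕋²))`. -/
def IsStochasticConvolution (L : ℝ) [Fact (0 < 2 * L)] (T : ℝ≥0) {Ω : Type*} [MeasurableSpace Ω]
    (P : Measure Ω) (e : ℤ × ℤ → C(Torus L, ℂ)) (β : ℤ × ℤ → ℝ≥0 → Ω → ℝ)
    (Z : ℝ≥0 → Ω → Lp ℂ 2 (torusMeasure L)) : Prop :=
  ∀ t ≤ T, AEStronglyMeasurable (Z t) P ∧ ∃ I : ℤ × ℤ → Ω → ℝ,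
    (∀ j, IsWienerIntegral P (β j) t
      (fun u => Real.exp (((t : ℝ) - u) * eigenvalue L 1 j)) (I j)) ∧
    Tendsto (fun F : Finset (ℤ × ℤ) => eLpNorm (fun ω => Z t ω -
      ∑ j ∈ F, ((I j ω : ℝ) : ℂ) • ContinuousMap.toLp 2 (torusMeasure L) ℂ (e j)) 2 P)
      atTop (𝓝 0)

end SwiftHohenberg

end

open SwiftHohenberg

noncomputable section
namespace SwiftHohenberg

/-! Write `μ_j = 1 - λ_{j,0} ≥ 1`, so that `λ_{j,1} = 2 - μ_j`. By the Itô isometry, the variance of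
the increment over `[t', t]` of the `j`-th coefficient of `Z` is the squared `L²(ℝ)`-distance of the
two exponential integrands. It is at most `C_T |t - t'|^γ μ_j^(γ-1)` for every `γ ∈ [0,1]`
(`integral_sq_convIntegrand_sub_le`): time regularity is bought with powers of `μ_j`. Since `μ_j`
dominates constant multiples of both `(1 + k²)²` and `1 + l²`, the sum of `μ_j^(-r)` is finite for
`r > 3/4` (`summable_rpow_one_sub_eigenvalue`). After applying `(1 - 𝓛₀)^{s/2}` the variances sum to
at most `C |t - t'|^γ ∑ μ_j^(s+γ-1)`, which is finite when `s + γ < 1/4`.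

The modes are uniformly bounded, so this controls the variance at every point of the torus. At a
fixed point the series is Gaussian, hence its `L^q(Ω)`-norm is bounded by its standard deviation up
to a constant. Tonelli's theorem with one exponent `q ≥ p` on both `Ω` and `𝕋²` gives `E ‖V(t) -
V(t')‖_p^q ≤ C |t - t'|^(γq/2)` for `V = (1 - 𝓛₀)^{s/2} Z` (`eLpNorm_sum_smul_toLp_le`,
`norm_convolutionSeries_sub_le`). Kolmogorov's theorem, proved by dyadic chaining, then yields
`α`-Hölder paths whenever `αq + 1 < γq/2`. Such a `q` exists as soon as `2α < γ < 1/4 - s`. The same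
argument bounds the mean of the oscillation, and `V(0) = 0`.

The limit processes are tied to `Z` through Fourier coefficients, which are continuous functionals
that separate points. For a bound of the mean independent of `s` and `α`, a second modification is
built with `s = 0` and fixed exponents. Both have continuous coefficients, so almost surely they
represent the same distribution at all times. -/

/-! ### Moments of centred Gaussian variables -/

section GaussianMoments

/-- The `L^q`-norm of a standard normal variable. -/
def gaussianMoment (q : ℝ≥0∞) : ℝ≥0∞ := eLpNorm id q (gaussianReal 0 1)

theorem gaussianMoment_ne_top {q : ℝ≥0∞} (hq : q ≠ ∞) : gaussianMoment q ≠ ∞ :=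
  (memLp_id_gaussianReal' q hq).eLpNorm_ne_top

theorem gaussianMoment_two : gaussianMoment 2 = 1 := by
  have h := memLp_id_gaussianReal (μ := 0) (v := 1) 2
  have hv := variance_id_gaussianReal (μ := 0) (v := 1)
  rw [variance_eq_integral aemeasurable_id] at hv
  simp only [id_eq, integral_id_gaussianReal, sub_zero] at hv
  unfold gaussianMoment
  rw [show (2 : ℝ≥0∞) = ((2 : ℝ≥0) : ℝ≥0∞) by simp,
    h.eLpNorm_eq_integral_rpow_norm (by simp) (by simp)]
  simp [hv]

variable {Ω : Type*} [MeasurableSpace Ω] {P : Measure Ω}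

/-- A centred Gaussian variable has the law of its standard deviation times a standard normal, so
its `L^q`-norms all scale with the standard deviation. The `L²`-norm is the standard deviation
itself because `gaussianMoment 2 = 1`. -/
theorem eLpNorm_gaussian {X : Ω → ℝ} (hX : HasGaussianLaw X P) (h0 : P[X] = 0) (q : ℝ≥0∞) :
    eLpNorm X q P = gaussianMoment q * eLpNorm X 2 P := by
  have key : ∀ r : ℝ≥0∞, eLpNorm X r P = ‖Real.sqrt Var[X; P]‖ₑ * gaussianMoment r := by
    intro r
    have h1 : P.map X = (gaussianReal 0 1).map (fun x => Real.sqrt Var[X; P] * x) := by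
      rw [gaussianReal_map_const_mul, hX.map_eq_gaussianReal, h0, mul_zero, mul_one]
      congr 1
      ext
      simp [Real.sq_sqrt (variance_nonneg X P), Real.coe_toNNReal _ (variance_nonneg X P)]
    calc eLpNorm X r P = eLpNorm id r (P.map X) := by
          rw [eLpNorm_map_measure aestronglyMeasurable_id hX.aemeasurable]; rfl
      _ = eLpNorm (fun x => Real.sqrt Var[X; P] * x) r (gaussianReal 0 1) := by
          rw [h1, eLpNorm_map_measure aestronglyMeasurable_id (by fun_prop)]; rfl
      _ = _ := eLpNorm_const_smul (Real.sqrt Var[X; P]) id r _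
  rw [key q, key 2, gaussianMoment_two, mul_one, mul_comm]

end GaussianMoments

/-! ### The Gaussian Hilbert space of a family of Brownian motions -/

section GaussianSpace

variable {Ω : Type*} [MeasurableSpace Ω] {P : Measure Ω} {β : ℤ × ℤ → ℝ≥0 → Ω → ℝ}

/-- Joint Gaussianity across modes comes from independence: independent Gaussian vectors form a
Gaussian vector. -/
theorem IsIndepBrownianFamily.isGaussianProcess (hβ : IsIndepBrownianFamily P β) :
    IsGaussianProcess (fun x : (ℤ × ℤ) × ℝ≥0 => β x.1 x.2) P where
  hasGaussianLaw I := by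
    classical
    -- The finite index set is enlarged to the grid `J × K`, where independence of the rows applies,
    -- and `A` projects back to `I`.
    let J := I.image Prod.fst
    let K := I.image Prod.snd
    have h1 : ∀ j : J, HasGaussianLaw (fun ω (t : K) => β j t ω) P := fun j =>
      have hj := hβ.brownian j
      hj.isGaussianProcess.hasGaussianLaw K
    have h2 : iIndepFun (fun (j : J) ω (t : K) => β j t ω) P :=
      (hβ.indep.precomp (g := ((↑) : J → ℤ × ℤ)) Subtype.val_injective).comp
        (fun _ (x : ℝ≥0 → ℝ) (t : K) => x t) (fun _ => by fun_prop)
    have h3 := h2.hasGaussianLaw h1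
    have hJ : ∀ i : I, i.1.1 ∈ J := fun i => Finset.mem_image_of_mem _ i.2
    have hK : ∀ i : I, i.1.2 ∈ K := fun i => Finset.mem_image_of_mem _ i.2
    let A : (J → K → ℝ) →L[ℝ] (I → ℝ) := ContinuousLinearMap.pi fun i =>
      (ContinuousLinearMap.proj (R := ℝ) (φ := fun _ : K => ℝ) ⟨i.1.2, hK i⟩).comp
        (ContinuousLinearMap.proj (R := ℝ) (φ := fun _ : J => K → ℝ) ⟨i.1.1, hJ i⟩)
    exact h3.map_fun A

theorem IsIndepBrownianFamily.memLp (hβ : IsIndepBrownianFamily P β) (x : (ℤ × ℤ) × ℝ≥0) :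
    MemLp (β x.1 x.2) 2 P :=
  (hβ.isGaussianProcess.hasGaussianLaw_eval x).memLp_two

/-- The value `β_j(t)` of a Brownian motion as an element of `L²(Ω)`. -/
def brownianLp (hβ : IsIndepBrownianFamily P β) (x : (ℤ × ℤ) × ℝ≥0) : Lp ℝ 2 P :=
  (hβ.memLp x).toLp

/-- The closed linear span of the variables `β_j(t)` in `L²(Ω)`. -/
def gaussianSpace (hβ : IsIndepBrownianFamily P β) : Submodule ℝ (Lp ℝ 2 P) :=
  (Submodule.span ℝ (range (brownianLp hβ))).topologicalClosure

theorem hasGaussianLaw_of_mem_span (hβ : IsIndepBrownianFamily P β) {X : Lp ℝ 2 P}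
    (hX : X ∈ Submodule.span ℝ (range (brownianLp hβ))) :
    HasGaussianLaw X P ∧ P[X] = 0 := by
  obtain ⟨c, rfl⟩ := Finsupp.mem_span_range_iff_exists_finsupp.mp hX
  have hc : ((c.sum fun i a => a • brownianLp hβ i : Lp ℝ 2 P) : Ω → ℝ) =ᵐ[P]
      fun ω => ∑ i ∈ c.support, c i * β i.1 i.2 ω := by
    have h1 := Lp.coeFn_finsetSum c.support (fun i => c i • brownianLp hβ i)
    refine h1.trans ?_
    have h2 : ∀ᵐ ω ∂P, ∀ i ∈ c.support, (c i • brownianLp hβ i : Lp ℝ 2 P) ω =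
        c i * β i.1 i.2 ω := by
      rw [Finset.eventually_all]
      intro i _
      filter_upwards [Lp.coeFn_smul (c i) (brownianLp hβ i), (hβ.memLp i).coeFn_toLp] with ω h h'
      rw [h, Pi.smul_apply, smul_eq_mul, brownianLp, h']
    filter_upwards [h2] with ω h
    rw [Finset.sum_apply]
    exact Finset.sum_congr rfl h
  constructor
  · refine HasGaussianLaw.congr ?_ hc.symm
    have := ((hβ.isGaussianProcess.smul c).hasGaussianLaw_fun_sum (I := c.support))
    simpa using this
  · rw [integral_congr_ae hc, integral_finsetSum]
    · refine Finset.sum_eq_zero fun i _ => ?_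
      rw [integral_const_mul, (hβ.brownian i.1).integral_eval, mul_zero]
    · intro i _
      exact ((hβ.brownian i.1).integrable_eval i.2).const_mul _

/-- All moments of a variable in the Gaussian Hilbert space are controlled by the second one. -/
theorem eLpNorm_le_of_mem_gaussianSpace (hβ : IsIndepBrownianFamily P β) {X : Lp ℝ 2 P}
    (hX : X ∈ gaussianSpace hβ) {q : ℝ≥0∞} (hq : q ≠ ∞) :
    eLpNorm X q P ≤ gaussianMoment q * ‖X‖ₑ := by
  have hX' : X ∈ closure (Submodule.span ℝ (range (brownianLp hβ)) : Set (Lp ℝ 2 P)) := hX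
  obtain ⟨x, hx, hlim⟩ := mem_closure_iff_seq_limit.mp hX'
  obtain ⟨ns, hns, hae⟩ := (tendstoInMeasure_of_tendsto_Lp hlim).exists_seq_tendsto_ae
  -- Fatou along an almost surely convergent subsequence. On the span the moment relation is an
  -- equality, so the right-hand side converges to the claimed bound.
  have h1 : eLpNorm X q P ≤ liminf (fun n => eLpNorm (x (ns n)) q P) atTop :=
    Lp.eLpNorm_lim_le_liminf_eLpNorm (fun n => (Lp.memLp _).1) _ hae
  refine h1.trans ?_
  have h2 : ∀ n, eLpNorm (x (ns n)) q P = gaussianMoment q * ‖x (ns n)‖ₑ := fun n => by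
    obtain ⟨h3, h4⟩ := hasGaussianLaw_of_mem_span hβ (hx (ns n))
    rw [eLpNorm_gaussian h3 h4 q, Lp.enorm_def]
  simp_rw [h2]
  refine (Tendsto.liminf_eq ?_).le
  exact ENNReal.Tendsto.const_mul
    ((continuous_enorm.tendsto X).comp (hlim.comp hns.tendsto_atTop))
    (Or.inr (gaussianMoment_ne_top hq))

end GaussianSpace

/-! ### The isometry between functions of time and Wiener integrals -/

section WienerIsometry

/-- The indicator function of `(0,t]` in `L²(ℝ)`. -/
def initialIntervalLp (t : ℝ≥0) : Lp ℝ 2 (volume : Measure ℝ) :=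
  indicatorConstLp 2 (measurableSet_Ioc (a := (0 : ℝ)) (b := t)) (by simp) 1

theorem inner_initialIntervalLp (s t : ℝ≥0) :
    inner ℝ (initialIntervalLp s) (initialIntervalLp t) = min (s : ℝ) t := by
  unfold initialIntervalLp
  rw [L2.inner_indicatorConstLp_indicatorConstLp (hμs := by simp) (hμt := by simp)]
  simp [Ioc_inter_Ioc]

variable {Ω : Type*} [MeasurableSpace Ω] {P : Measure Ω} {β : ℤ × ℤ → ℝ≥0 → Ω → ℝ}

theorem inner_brownianLp (hβ : IsIndepBrownianFamily P β) (x y : (ℤ × ℤ) × ℝ≥0) :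
    inner ℝ (brownianLp hβ x) (brownianLp hβ y) = ∫ ω, β x.1 x.2 ω * β y.1 y.2 ω ∂P := by
  rw [L2.inner_def]
  refine integral_congr_ae ?_
  filter_upwards [(hβ.memLp x).coeFn_toLp, (hβ.memLp y).coeFn_toLp] with ω h h'
  rw [brownianLp, brownianLp, h, h']
  simp [mul_comm]

/-- The covariance `min s t` agrees with `inner_initialIntervalLp`: this equality of Gram matrices
is the Itô isometry on generators. -/
theorem inner_brownianLp_same (hβ : IsIndepBrownianFamily P β) (j : ℤ × ℤ) (s t : ℝ≥0) :
    inner ℝ (brownianLp hβ (j, s)) (brownianLp hβ (j, t)) = min (s : ℝ) t := by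
  have := hβ.isGaussianProcess.isProbabilityMeasure
  rw [inner_brownianLp]
  have h := (hβ.brownian j).covariance_eval s t
  rw [covariance_eq_sub (hβ.memLp (j, s)) (hβ.memLp (j, t)),
    (hβ.brownian j).integral_eval, (hβ.brownian j).integral_eval] at h
  simpa using h

theorem inner_brownianLp_of_ne (hβ : IsIndepBrownianFamily P β) {i j : ℤ × ℤ} (hij : i ≠ j)
    (s t : ℝ≥0) : inner ℝ (brownianLp hβ (i, s)) (brownianLp hβ (j, t)) = 0 := by
  rw [inner_brownianLp]
  have h1 : IndepFun (β i s) (β j t) P :=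
    (hβ.indep.indepFun hij).comp (measurable_pi_apply s) (measurable_pi_apply t)
  have h2 := h1.integral_mul_eq_mul_integral (hβ.measurable i s).aestronglyMeasurable
    (hβ.measurable j t).aestronglyMeasurable
  rw [(hβ.brownian i).integral_eval, zero_mul] at h2
  exact h2

/-- The graph of the map that sends the indicator function of `(0,t]` to `β_j(t)`, extended to
the closed linear span. -/
def wienerGraph (hβ : IsIndepBrownianFamily P β) (j : ℤ × ℤ) :
    Submodule ℝ (Lp ℝ 2 (volume : Measure ℝ) × Lp ℝ 2 P) :=
  (Submodule.span ℝ (range fun t => (initialIntervalLp t, brownianLp hβ (j, t)))).topologicalClosure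

/-- The Itô isometry in graph form. It holds on generators by comparing covariances, extends to the
span by bilinearity, and to the closure by continuity in one variable at a time. Using a closed
graph makes it unnecessary to check first that the integral is a well-defined map. -/
theorem inner_eq_of_mem_wienerGraph (hβ : IsIndepBrownianFamily P β) {j : ℤ × ℤ}
    {x y : Lp ℝ 2 (volume : Measure ℝ) × Lp ℝ 2 P} (hx : x ∈ wienerGraph hβ j)
    (hy : y ∈ wienerGraph hβ j) : inner ℝ x.1 y.1 = inner ℝ x.2 y.2 := by
  have h1 : ∀ x ∈ Submodule.span ℝ (range fun t => (initialIntervalLp t, brownianLp hβ (j, t))),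
      ∀ y ∈ Submodule.span ℝ (range fun t => (initialIntervalLp t, brownianLp hβ (j, t))),
      inner ℝ x.1 y.1 = inner ℝ x.2 y.2 := by
    intro x hx y hy
    induction hx, hy using Submodule.span_induction₂ with
    | mem_mem x y hx hy =>
      obtain ⟨s, rfl⟩ := hx
      obtain ⟨t, rfl⟩ := hy
      simp only [inner_initialIntervalLp, inner_brownianLp_same]
    | zero_left y hy => simp
    | zero_right x hx => simp
    | add_left x y z _ _ _ h h' => simp [inner_add_left, h, h']
    | add_right x y z _ _ _ h h' => simp [inner_add_right, h, h']
    | smul_left r x y _ _ h => simp [real_inner_smul_left, h]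
    | smul_right r x y _ _ h => simp [real_inner_smul_right, h]
  have h2 : ∀ x ∈ Submodule.span ℝ (range fun t => (initialIntervalLp t, brownianLp hβ (j, t))),
      ∀ y ∈ wienerGraph hβ j, inner ℝ x.1 y.1 = inner ℝ x.2 y.2 := fun x hx y hy =>
    closure_minimal (h1 x hx) (isClosed_eq (by fun_prop) (by fun_prop)) hy
  exact closure_minimal (fun x hx => h2 x hx y hy)
    (isClosed_eq (f := fun x : Lp ℝ 2 (volume : Measure ℝ) × Lp ℝ 2 P => inner ℝ x.1 y.1)
      (g := fun x => inner ℝ x.2 y.2) (by fun_prop) (by fun_prop)) hx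

theorem norm_eq_of_mem_wienerGraph (hβ : IsIndepBrownianFamily P β) {j : ℤ × ℤ}
    {x : Lp ℝ 2 (volume : Measure ℝ) × Lp ℝ 2 P} (hx : x ∈ wienerGraph hβ j) :
    ‖x.2‖ = ‖x.1‖ := by
  have h := inner_eq_of_mem_wienerGraph hβ hx hx
  rw [real_inner_self_eq_norm_sq, real_inner_self_eq_norm_sq] at h
  exact ((sq_eq_sq₀ (norm_nonneg _) (norm_nonneg _)).mp h).symm

/-- Different Brownian motions are independent and centred, hence orthogonal on generators; the
extension is the same as for the isometry. -/
theorem inner_eq_zero_of_mem_wienerGraph (hβ : IsIndepBrownianFamily P β) {i j : ℤ × ℤ}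
    (hij : i ≠ j) {x y : Lp ℝ 2 (volume : Measure ℝ) × Lp ℝ 2 P} (hx : x ∈ wienerGraph hβ i)
    (hy : y ∈ wienerGraph hβ j) : inner ℝ x.2 y.2 = 0 := by
  have h1 : ∀ x ∈ Submodule.span ℝ (range fun t => (initialIntervalLp t, brownianLp hβ (i, t))),
      ∀ y ∈ Submodule.span ℝ (range fun t => (initialIntervalLp t, brownianLp hβ (j, t))),
      inner ℝ x.2 y.2 = 0 := by
    intro x hx y hy
    induction hx, hy using Submodule.span_induction₂ with
    | mem_mem x y hx hy =>
      obtain ⟨s, rfl⟩ := hx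
      obtain ⟨t, rfl⟩ := hy
      exact inner_brownianLp_of_ne hβ hij s t
    | zero_left y hy => simp
    | zero_right x hx => simp
    | add_left x y z _ _ _ h h' => simp [inner_add_left, h, h']
    | add_right x y z _ _ _ h h' => simp [inner_add_right, h, h']
    | smul_left r x y _ _ h => simp [real_inner_smul_left, h]
    | smul_right r x y _ _ h => simp [real_inner_smul_right, h]
  have h2 : ∀ x ∈ Submodule.span ℝ (range fun t => (initialIntervalLp t, brownianLp hβ (i, t))),
      ∀ y ∈ wienerGraph hβ j, inner ℝ x.2 y.2 = 0 := fun x hx y hy =>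
    closure_minimal (h1 x hx) (isClosed_eq (by fun_prop) (by fun_prop)) hy
  exact closure_minimal (fun x hx => h2 x hx y hy)
    (isClosed_eq (f := fun x : Lp ℝ 2 (volume : Measure ℝ) × Lp ℝ 2 P => inner ℝ x.2 y.2)
      (g := fun _ => 0) (by fun_prop) (by fun_prop)) hx

theorem snd_mem_gaussianSpace (hβ : IsIndepBrownianFamily P β) {j : ℤ × ℤ}
    {x : Lp ℝ 2 (volume : Measure ℝ) × Lp ℝ 2 P} (hx : x ∈ wienerGraph hβ j) :
    x.2 ∈ gaussianSpace hβ := by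
  have h : Submodule.span ℝ (range fun t => (initialIntervalLp t, brownianLp hβ (j, t))) ≤
      (gaussianSpace hβ).comap (LinearMap.snd ℝ _ _) := by
    refine Submodule.span_le.mpr ?_
    rintro _ ⟨t, rfl⟩
    exact Submodule.le_topologicalClosure _ (Submodule.subset_span ⟨(j, t), rfl⟩)
  exact closure_minimal h
    ((Submodule.isClosed_topologicalClosure _).preimage continuous_snd) hx

/-- The step function `∑_{i<n} c_i 1_{(τ_i, τ_{i+1}]}` is square integrable. -/
theorem memLp_stepFunction (n : ℕ) (τ : ℕ → ℝ≥0) (c : ℕ → ℝ) :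
    MemLp (stepFunction n τ c) 2 volume := by
  have : stepFunction n τ c = ∑ i ∈ Finset.range n,
      (Ioc (τ i : ℝ) (τ (i + 1) : ℝ)).indicator (fun _ => c i) := by
    ext u; simp [stepFunction]
  rw [this]
  exact memLp_finsetSum' _ fun i _ => memLp_indicator_const 2 measurableSet_Ioc _ (Or.inr (by simp))

theorem memLp_stepIntegral (hβ : IsIndepBrownianFamily P β) (j : ℤ × ℤ) (n : ℕ) (τ : ℕ → ℝ≥0)
    (c : ℕ → ℝ) : MemLp (stepIntegral (β j) n τ c) 2 P := by
  have : stepIntegral (β j) n τ c = ∑ i ∈ Finset.range n,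
      c i • (β j (τ (i + 1)) - β j (τ i)) := by
    ext u; simp [stepIntegral]
  rw [this]
  exact memLp_finsetSum' _ fun i _ =>
    ((hβ.memLp (j, τ (i + 1))).sub (hβ.memLp (j, τ i))).const_smul _

/-- The indicator of `(τ_i, τ_{i+1}]` is the difference of two initial-interval indicators, and the
corresponding difference on the other side is the Brownian increment. -/
theorem mem_wienerGraph_of_step (hβ : IsIndepBrownianFamily P β) (j : ℤ × ℤ) (n : ℕ)
    {τ : ℕ → ℝ≥0} (hτ : Monotone τ) (c : ℕ → ℝ) :
    ((memLp_stepFunction n τ c).toLp, (memLp_stepIntegral hβ j n τ c).toLp) ∈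
      wienerGraph hβ j := by
  have h : ((memLp_stepFunction n τ c).toLp, (memLp_stepIntegral hβ j n τ c).toLp) =
      ∑ i ∈ Finset.range n, c i • ((initialIntervalLp (τ (i + 1)), brownianLp hβ (j, τ (i + 1))) -
        (initialIntervalLp (τ i), brownianLp hβ (j, τ i))) := by
    refine Prod.ext ?_ ?_
    · rw [Prod.fst_sum]
      ext1
      refine (memLp_stepFunction n τ c).coeFn_toLp.trans ?_
      refine EventuallyEq.symm ((Lp.coeFn_finsetSum _ _).trans ?_)
      have h2 : ∀ᵐ u : ℝ, ∀ i ∈ Finset.range n,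
          (c i • (initialIntervalLp (τ (i + 1)) - initialIntervalLp (τ i)) :
            Lp ℝ 2 (volume : Measure ℝ)) u =
          (Ioc (τ i : ℝ) (τ (i + 1) : ℝ)).indicator (fun _ => c i) u := by
        rw [Finset.eventually_all]
        intro i _
        filter_upwards [Lp.coeFn_smul (c i) (initialIntervalLp (τ (i + 1)) - initialIntervalLp (τ i)),
          Lp.coeFn_sub (initialIntervalLp (τ (i + 1))) (initialIntervalLp (τ i)),
          indicatorConstLp_coeFn (p := 2) (hs := measurableSet_Ioc (a := (0 : ℝ)) (b := τ (i + 1)))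
            (hμs := by simp) (c := (1 : ℝ)),
          indicatorConstLp_coeFn (p := 2) (hs := measurableSet_Ioc (a := (0 : ℝ)) (b := τ i))
            (hμs := by simp) (c := (1 : ℝ))] with u h1 h2 h3 h4
        rw [h1, Pi.smul_apply, h2, Pi.sub_apply, initialIntervalLp, initialIntervalLp, h3, h4]
        -- Without monotonicity the difference of indicators would carry a negative sign where the
        -- half-open interval is empty.
        have h5 : (τ i : ℝ) ≤ τ (i + 1) := hτ (Nat.le_succ i)
        have h6 : (0 : ℝ) ≤ τ i := (τ i).2
        simp only [indicator, mem_Ioc, smul_eq_mul]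
        split_ifs <;> simp <;> grind
      filter_upwards [h2] with u h2
      rw [Finset.sum_apply]
      exact Finset.sum_congr rfl h2
    · rw [Prod.snd_sum]
      ext1
      refine (memLp_stepIntegral hβ j n τ c).coeFn_toLp.trans ?_
      refine EventuallyEq.symm ((Lp.coeFn_finsetSum _ _).trans ?_)
      have h2 : ∀ᵐ ω ∂P, ∀ i ∈ Finset.range n,
          (c i • (brownianLp hβ (j, τ (i + 1)) - brownianLp hβ (j, τ i)) : Lp ℝ 2 P) ω =
          c i * (β j (τ (i + 1)) ω - β j (τ i) ω) := by
        rw [Finset.eventually_all]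
        intro i _
        filter_upwards [Lp.coeFn_smul (c i) (brownianLp hβ (j, τ (i + 1)) - brownianLp hβ (j, τ i)),
          Lp.coeFn_sub (brownianLp hβ (j, τ (i + 1))) (brownianLp hβ (j, τ i)),
          (hβ.memLp (j, τ (i + 1))).coeFn_toLp, (hβ.memLp (j, τ i)).coeFn_toLp] with u h1 h2 h3 h4
        rw [h1, Pi.smul_apply, h2, Pi.sub_apply, brownianLp, brownianLp, h3, h4, smul_eq_mul]
      filter_upwards [h2] with u h2
      rw [Finset.sum_apply]
      exact Finset.sum_congr rfl h2
  rw [h]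
  refine Submodule.sum_mem _ fun i _ => Submodule.smul_mem _ _ (Submodule.sub_mem _ ?_ ?_) <;>
    exact Submodule.le_topologicalClosure _ (Submodule.subset_span ⟨_, rfl⟩)

end WienerIsometry

/-! ### Wiener integrals as limits of step integrals: membership in the graph and existence. -/

section WienerIntegral

/-- Nodes in `[0,t]` force the step function to vanish off `(0,t]`, so the norm over `(0,t]` in
`IsWienerIntegral` can be read as a norm in `L²(ℝ)`. -/
theorem eLpNorm_indicator_sub_stepFunction {n : ℕ} {τ : ℕ → ℝ≥0} {t : ℝ≥0} (hτ : ∀ i, τ i ≤ t)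
    (c : ℕ → ℝ) (f : ℝ → ℝ) :
    eLpNorm (stepFunction n τ c - (Ioc (0 : ℝ) t).indicator f) 2 volume =
      eLpNorm (fun u => f u - stepFunction n τ c u) 2 (volume.restrict (Ioc (0 : ℝ) t)) := by
  rw [← eLpNorm_indicator_eq_eLpNorm_restrict measurableSet_Ioc, eLpNorm_sub_comm]
  congr 1
  ext u
  by_cases hu : u ∈ Ioc (0 : ℝ) t
  · simp [hu]
  · have : stepFunction n τ c u = 0 := by
      refine Finset.sum_eq_zero fun i _ => indicator_of_notMem (fun h => hu ?_) _
      exact ⟨(τ i).2.trans_lt h.1, h.2.trans (by exact_mod_cast hτ (i + 1))⟩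
    simp [hu, this]

variable {Ω : Type*} [MeasurableSpace Ω] {P : Measure Ω} {β : ℤ × ℤ → ℝ≥0 → Ω → ℝ}

/-- The graph is closed and contains the approximating pairs of step functions and step integrals,
so it contains their limit. -/
theorem IsWienerIntegral.mem_wienerGraph (hβ : IsIndepBrownianFamily P β) {j : ℤ × ℤ} {t : ℝ≥0}
    {f : ℝ → ℝ} {I : Ω → ℝ} (h : IsWienerIntegral P (β j) t f I) :
    ∃ (hf : MemLp ((Ioc (0 : ℝ) t).indicator f) 2 volume) (hI : MemLp I 2 P),
      (hf.toLp, hI.toLp) ∈ wienerGraph hβ j := by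
  obtain ⟨hf, hI, n, τ, c, hmono, hle, h1, h2⟩ := h
  have hf' := (memLp_indicator_iff_restrict (measurableSet_Ioc (a := (0 : ℝ)) (b := t))).mpr hf
  have hI' : MemLp I 2 P := by
    -- A single step integral at finite `L²`-distance already shows that `I` is square integrable.
    obtain ⟨m, hm⟩ := (h2.eventually (gt_mem_nhds zero_lt_one)).exists
    have h3 := memLp_stepIntegral hβ j (n m) (τ m) (c m)
    have h4 : MemLp (fun ω => I ω - stepIntegral (β j) (n m) (τ m) (c m) ω) 2 P :=
      ⟨hI.sub h3.1, hm.trans ENNReal.one_lt_top⟩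
    convert h4.add h3 using 1
    ext ω; simp
  refine ⟨hf', hI', ?_⟩
  refine mem_closure_of_tendsto (b := atTop) (f := fun m =>
    ((memLp_stepFunction (n m) (τ m) (c m)).toLp,
      (memLp_stepIntegral hβ j (n m) (τ m) (c m)).toLp)) ?_
    (Eventually.of_forall fun m => mem_wienerGraph_of_step hβ j (n m) (hmono m) (c m)) |>
    (Submodule.isClosed_topologicalClosure _).closure_subset
  refine Tendsto.prodMk_nhds ?_ ?_
  · rw [Lp.tendsto_Lp_iff_tendsto_eLpNorm'']
    simpa only [eLpNorm_indicator_sub_stepFunction (hle _)] using h1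
  · rw [Lp.tendsto_Lp_iff_tendsto_eLpNorm'']
    simp_rw [eLpNorm_sub_comm (stepIntegral _ _ _ _)]
    exact h2

theorem stepFunction_eq {n : ℕ} {τ : ℕ → ℝ≥0} (hτ : Monotone τ) (c : ℕ → ℝ) {i : ℕ} (hi : i < n)
    {u : ℝ} (hu : u ∈ Ioc (τ i : ℝ) (τ (i + 1) : ℝ)) : stepFunction n τ c u = c i := by
  unfold stepFunction
  rw [Finset.sum_eq_single i, indicator_of_mem hu]
  · intro k _ hk
    refine indicator_of_notMem (fun h => ?_) _
    rcases lt_or_gt_of_ne hk with hk | hk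
    · have : (τ (k + 1) : ℝ) ≤ τ i := hτ hk
      linarith [h.2, hu.1]
    · have : (τ (i + 1) : ℝ) ≤ τ k := hτ hk
      linarith [h.1, hu.2]
  · intro h
    exact absurd (Finset.mem_range.mpr hi) h

/-- The uniform partition of `[0,t]` into `m + 1` intervals. -/
def uniformPartition (t : ℝ≥0) (m i : ℕ) : ℝ≥0 := min (i * (t / (m + 1))) t

theorem monotone_uniformPartition (t : ℝ≥0) (m : ℕ) : Monotone (uniformPartition t m) := by
  intro i k hik
  unfold uniformPartition
  gcongr

theorem exists_mem_uniformPartition {t : ℝ≥0} (m : ℕ) {u : ℝ} (hu : u ∈ Ioc (0 : ℝ) t) :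
    ∃ i < m + 1, u ∈ Ioc (uniformPartition t m i : ℝ) (uniformPartition t m (i + 1) : ℝ) := by
  have h := (monotone_uniformPartition t m).biUnion_Ico_Ioc_map_succ 0 (m + 1)
  have h0 : uniformPartition t m 0 = 0 := by simp [uniformPartition]
  have h1 : uniformPartition t m (m + 1) = t := by
    unfold uniformPartition
    rw [Nat.cast_add, Nat.cast_one, mul_div_cancel₀ _ (by positivity), min_self]
  rw [h0, h1] at h
  have h2 : (⟨u, hu.1.le⟩ : ℝ≥0) ∈ Ioc 0 t := ⟨hu.1, hu.2⟩
  rw [← h] at h2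
  obtain ⟨i, hi, h3⟩ := mem_iUnion₂.mp h2
  exact ⟨i, hi.2, h3.1, h3.2⟩

theorem uniformPartition_succ_sub_le (t : ℝ≥0) (m i : ℕ) :
    (uniformPartition t m (i + 1) : ℝ) - uniformPartition t m i ≤ t / (m + 1) := by
  unfold uniformPartition
  push_cast
  have h : (0 : ℝ) ≤ t / (m + 1) := by positivity
  rcases min_cases ((i : ℝ) * (t / (m + 1))) (t : ℝ) with ⟨h1, _⟩ | ⟨h1, _⟩ <;>
  rcases min_cases (((i : ℝ) + 1) * (t / (m + 1))) (t : ℝ) with ⟨h2, _⟩ | ⟨h2, _⟩ <;>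
  rw [h1, h2] <;> linarith

/-- Uniform continuity on `[0,t]` makes the left-endpoint step functions converge uniformly on
`(0,t]`, which has finite measure. -/
theorem tendsto_eLpNorm_sub_stepFunction {f : ℝ → ℝ} (hf : Continuous f) (t : ℝ≥0) :
    Tendsto (fun m : ℕ => eLpNorm (fun u => f u - stepFunction (m + 1) (uniformPartition t m)
      (fun i => f (uniformPartition t m i)) u) 2 (volume.restrict (Ioc (0 : ℝ) t)))
      atTop (𝓝 0) := by
  have hlim : Tendsto (fun δ : ℝ => (volume.restrict (Ioc (0 : ℝ) t)) univ ^ (2 : ℝ≥0∞).toReal⁻¹ *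
      ENNReal.ofReal δ) (𝓝[>] 0) (𝓝 0) := by
    have h1 : Tendsto ENNReal.ofReal (𝓝[>] 0) (𝓝 0) := by
      have := (ENNReal.continuous_ofReal.tendsto 0).mono_left (nhdsWithin_le_nhds (s := Ioi 0))
      rwa [ENNReal.ofReal_zero] at this
    have := ENNReal.Tendsto.const_mul (a := (volume.restrict (Ioc (0 : ℝ) t)) univ ^
      (2 : ℝ≥0∞).toReal⁻¹) h1 (Or.inr (by simp))
    rwa [mul_zero] at this
  rw [ENNReal.tendsto_nhds_zero] at hlim ⊢
  intro ε hε
  obtain ⟨δ, hδε, hδ⟩ := ((hlim ε hε).and self_mem_nhdsWithin).exists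
  have huc := (isCompact_Icc (a := (0 : ℝ)) (b := t)).uniformContinuousOn_of_continuous
    hf.continuousOn
  obtain ⟨η, hη, huc⟩ := Metric.uniformContinuousOn_iff.mp huc δ hδ
  have hm : ∀ᶠ m : ℕ in atTop, (t : ℝ) / (m + 1) < η := by
    have := (tendsto_const_div_atTop_nhds_zero_nat (t : ℝ)).comp (tendsto_add_atTop_nat 1)
    filter_upwards [this.eventually (gt_mem_nhds hη)] with m hm
    simpa using hm
  filter_upwards [hm] with m hm
  refine (eLpNorm_le_of_ae_bound (C := δ) ?_).trans hδε
  refine (ae_restrict_iff' measurableSet_Ioc).mpr (Eventually.of_forall fun u hu => ?_)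
  obtain ⟨i, hi, hiu⟩ := exists_mem_uniformPartition m hu
  rw [stepFunction_eq (monotone_uniformPartition t m) _ hi hiu]
  have h1 := uniformPartition_succ_sub_le t m i
  have h2 : (uniformPartition t m i : ℝ) ≤ t := by
    exact_mod_cast min_le_right _ _
  refine (huc u ⟨hu.1.le, hu.2⟩ _ ⟨NNReal.coe_nonneg _, h2⟩ ?_).le
  obtain ⟨h3, h4⟩ := mem_Ioc.mp hiu
  rw [Real.dist_eq, abs_of_pos (sub_pos.mpr h3)]
  exact ((sub_le_sub_right h4 _).trans h1).trans_lt hm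

/-- The step functions converge in `L²(ℝ)`, the isometry makes their integrals Cauchy in `L²(Ω)`,
and completeness supplies the integral. -/
theorem exists_isWienerIntegral (hβ : IsIndepBrownianFamily P β) (j : ℤ × ℤ) (t : ℝ≥0)
    {f : ℝ → ℝ} (hf : Continuous f) : ∃ I : Ω → ℝ, IsWienerIntegral P (β j) t f I := by
  have hfr : MemLp f 2 (volume.restrict (Ioc (0 : ℝ) t)) := by
    obtain ⟨C, hC⟩ := (isCompact_Icc (a := (0 : ℝ)) (b := t)).exists_bound_of_continuousOn
      hf.continuousOn
    refine MemLp.of_bound hf.aestronglyMeasurable C ?_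
    exact (ae_restrict_iff' measurableSet_Ioc).mpr
      (Eventually.of_forall fun u hu => hC u (Ioc_subset_Icc_self hu))
  have hf' := (memLp_indicator_iff_restrict (measurableSet_Ioc (a := (0 : ℝ)) (b := t))).mpr hfr
  let c : ℕ → ℕ → ℝ := fun m i => f (uniformPartition t m i)
  let S : ℕ → Lp ℝ 2 (volume : Measure ℝ) := fun m =>
    (memLp_stepFunction (m + 1) (uniformPartition t m) (c m)).toLp
  let X : ℕ → Lp ℝ 2 P := fun m =>
    (memLp_stepIntegral hβ j (m + 1) (uniformPartition t m) (c m)).toLp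
  -- The cap at `t` in `uniformPartition` is there for the nodes beyond index `m + 1`:
  -- `IsWienerIntegral` asks for the bound at every index.
  have hle : ∀ m i, uniformPartition t m i ≤ t := fun m i => min_le_right _ _
  have hlim := tendsto_eLpNorm_sub_stepFunction hf t
  have hS : Tendsto S atTop (𝓝 hf'.toLp) := by
    rw [Lp.tendsto_Lp_iff_tendsto_eLpNorm'']
    simpa only [eLpNorm_indicator_sub_stepFunction (hle _)] using hlim
  have hX : CauchySeq X := by
    have h := hS.cauchySeq
    rw [Metric.cauchySeq_iff] at h ⊢
    intro ε hε
    obtain ⟨N, hN⟩ := h ε hε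
    refine ⟨N, fun m hm n hn => ?_⟩
    have h1 := norm_eq_of_mem_wienerGraph hβ (Submodule.sub_mem _
      (mem_wienerGraph_of_step hβ j (m + 1) (monotone_uniformPartition t m) (c m))
      (mem_wienerGraph_of_step hβ j (n + 1) (monotone_uniformPartition t n) (c n)))
    have h2 := hN m hm n hn
    rw [dist_eq_norm] at h2 ⊢
    exact h1.trans_lt h2
  obtain ⟨I, hI⟩ := cauchySeq_tendsto_of_complete hX
  refine ⟨I, hfr, (Lp.memLp I).1, fun m => m + 1, uniformPartition t, c,
    monotone_uniformPartition t, hle, hlim, ?_⟩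
  rw [Lp.tendsto_Lp_iff_tendsto_eLpNorm'] at hI
  refine hI.congr fun m => ?_
  rw [eLpNorm_sub_comm]
  refine eLpNorm_congr_ae ?_
  filter_upwards [(memLp_stepIntegral hβ j (m + 1) (uniformPartition t m) (c m)).coeFn_toLp]
    with ω h
  rw [Pi.sub_apply]
  simp only [X, h]

end WienerIntegral

/-! ### Eigenvalue sums and the variance of the stochastic convolution -/

section Eigenvalues

/-- Hence `λ_{j,1} ≤ 1` and `2 - λ_{j,1} = 1 - λ_{j,0} ≥ 1`, the positive quantity in which the
variance estimates are expressed. -/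
theorem eigenvalue_one (L : ℝ) (j : ℤ × ℤ) :
    eigenvalue L 1 j = 2 - (1 - eigenvalue L 0 j) := by
  unfold eigenvalue; ring

/-- Comparison with the series of `|n + 1/2|^(-2r)`, whose shift keeps the base away from zero, by
`(n + 1/2)² ≤ 2 (1 + n²)`. -/
theorem summable_one_add_sq_rpow {r : ℝ} (hr : 1 / 2 < r) :
    Summable fun n : ℤ => (1 + (n : ℝ) ^ 2) ^ (-r) := by
  have h := ((Real.summable_one_div_int_add_rpow (1 / 2) (2 * r)).mpr (by linarith)).mul_left
    ((2 : ℝ) ^ r)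
  refine Summable.of_nonneg_of_le (fun n => by positivity) (fun n => ?_) h
  have hx : 0 < |(n : ℝ) + 1 / 2| := by
    rw [abs_pos]
    intro h0
    have : (2 * n + 1 : ℤ) = 0 := by
      have : (2 * n + 1 : ℝ) = 0 := by linarith
      exact_mod_cast this
    omega
  rw [Real.rpow_neg (by positivity), one_div, Real.rpow_mul hx.le, Real.rpow_two, sq_abs,
    ← div_eq_mul_inv, le_div_iff₀ (by rw [← sq_abs]; positivity), inv_mul_le_iff₀ (by positivity),
    ← Real.mul_rpow (by positivity) (by positivity)]
  exact Real.rpow_le_rpow (by positivity) (by nlinarith [sq_nonneg ((n : ℝ) - 1 / 2)])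
    (by linarith)

/-- With `μ = 1 - λ`, the quartic growth in `k` and quadratic growth in `l` are balanced by `μ^(-r)
= μ^(-r/3) μ^(-2r/3)`: the first factor is estimated through `k`, the second through `l`. Both
become `(1 + n²)^(-2r/3)`, summable exactly when `2r/3 > 1/2`, whence the threshold `3/4`. -/
theorem summable_rpow_one_sub_eigenvalue {L : ℝ} (hL : 0 < L) {r : ℝ} (hr : 3 / 4 < r) :
    Summable fun j : ℤ × ℤ => (1 - eigenvalue L 0 j) ^ (-r) := by
  set a := (Real.pi / L) ^ 2 with ha
  have ha0 : 0 < a := by positivity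
  set m := min 1 a with hm
  have hm0 : 0 < m := lt_min one_pos ha0
  have h1 := summable_one_add_sq_rpow (r := 2 * r / 3) (by linarith)
  have h2 := (h1.mul_of_nonneg h1 (fun n => by positivity) (fun n => by positivity)).mul_left
    ((m ^ 2 / 5) ^ (-(r / 3)) * m ^ (-(2 * r / 3)))
  refine Summable.of_nonneg_of_le
    (fun j => Real.rpow_nonneg (by linarith [one_le_one_sub_eigenvalue L j]) _) (fun j => ?_) h2
  have hμ := one_le_one_sub_eigenvalue L j
  -- The constant `5` comes from `5 (1 + (1 - y)²) - (1 + y)² = (3 - 2y)² ≥ 0` with `y = a k²`.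
  have hk : m ^ 2 / 5 * (1 + (j.1 : ℝ) ^ 2) ^ 2 ≤ 1 - eigenvalue L 0 j := by
    have h3 : m * (1 + (j.1 : ℝ) ^ 2) ≤ 1 + a * (j.1 : ℝ) ^ 2 := by
      nlinarith [min_le_left 1 a, min_le_right 1 a, sq_nonneg (j.1 : ℝ)]
    have h4 : (m * (1 + (j.1 : ℝ) ^ 2)) ^ 2 ≤ (1 + a * (j.1 : ℝ) ^ 2) ^ 2 :=
      pow_le_pow_left₀ (by positivity) h3 2
    have h5 : 0 ≤ a * (j.2 : ℝ) ^ 2 := by positivity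
    unfold eigenvalue
    rw [← ha]
    nlinarith [sq_nonneg (3 - 2 * (a * (j.1 : ℝ) ^ 2))]
  have hl : m * (1 + (j.2 : ℝ) ^ 2) ≤ 1 - eigenvalue L 0 j := by
    unfold eigenvalue
    rw [← ha]
    nlinarith [min_le_left 1 a, min_le_right 1 a, sq_nonneg (j.2 : ℝ),
      sq_nonneg (1 - a * (j.1 : ℝ) ^ 2)]
  have e1 : (1 - eigenvalue L 0 j) ^ (-r) =
      (1 - eigenvalue L 0 j) ^ (-(r / 3)) * (1 - eigenvalue L 0 j) ^ (-(2 * r / 3)) := by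
    rw [← Real.rpow_add (by linarith)]; congr 1; ring
  have e2 : (1 - eigenvalue L 0 j) ^ (-(r / 3)) ≤
      (m ^ 2 / 5) ^ (-(r / 3)) * (1 + (j.1 : ℝ) ^ 2) ^ (-(2 * r / 3)) := by
    refine (Real.rpow_le_rpow_of_nonpos (by positivity) hk (by linarith)).trans_eq ?_
    rw [Real.mul_rpow (by positivity) (by positivity), ← Real.rpow_natCast (1 + (j.1 : ℝ) ^ 2) 2,
      ← Real.rpow_mul (by positivity)]
    congr 2
    push_cast; ring
  have e3 : (1 - eigenvalue L 0 j) ^ (-(2 * r / 3)) ≤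
      m ^ (-(2 * r / 3)) * (1 + (j.2 : ℝ) ^ 2) ^ (-(2 * r / 3)) := by
    refine (Real.rpow_le_rpow_of_nonpos (by positivity) hl (by linarith)).trans_eq ?_
    rw [Real.mul_rpow (by positivity) (by positivity)]
  rw [e1]
  refine (mul_le_mul e2 e3 (Real.rpow_nonneg (by linarith) _) (by positivity)).trans_eq (by ring)

/-- Interpolation: it merges a bound in the time step and a bound in the eigenvalue into one with a
free exponent `γ`. -/
theorem min_le_rpow_mul_rpow {x y γ : ℝ} (hx : 0 ≤ x) (hy : 0 ≤ y) (h0 : 0 ≤ γ) (h1 : γ ≤ 1) :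
    min x y ≤ x ^ γ * y ^ (1 - γ) := by
  have hm : 0 ≤ min x y := le_min hx hy
  calc min x y = min x y ^ γ * min x y ^ (1 - γ) := by
        rw [← Real.rpow_add_of_nonneg hm h0 (by linarith)]; simp
    _ ≤ _ := by
        gcongr
        · exact min_le_left _ _
        · exact min_le_right _ _

/-- Since `lam` may be positive, write `lam = 2 - μ`: the growth `e^{4(b-u)}` is absorbed into
`e^{4T}`, and a decaying exponential remains. Its integral is at most the length of the interval and
at most `1/μ`. -/
theorem integral_exp_le {lam T a b : ℝ} (hl : lam ≤ 1) (hab : a ≤ b) (hT : b - a ≤ T) :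
    ∫ u in a..b, Real.exp ((b - u) * lam) ^ 2 ≤ Real.exp (4 * T) * min (b - a) (2 - lam)⁻¹ := by
  have hμ : 0 < 2 - lam := by linarith
  set μ := 2 - lam with hμdef
  have h1 : ∀ u ∈ Icc a b, Real.exp ((b - u) * lam) ^ 2 ≤
      Real.exp (4 * T) * Real.exp (-((b - u) * μ)) := by
    intro u hu
    rw [← Real.exp_nat_mul, ← Real.exp_add]
    refine Real.exp_le_exp.mpr ?_
    have := hu.1; have := hu.2
    have : lam = 2 - μ := by ring
    rw [this]; push_cast
    nlinarith [mul_nonneg (sub_nonneg.mpr hu.2) hμ.le]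
  have h2 : ∫ u in a..b, Real.exp ((b - u) * lam) ^ 2 ≤
      ∫ u in a..b, Real.exp (4 * T) * Real.exp (-((b - u) * μ)) :=
    intervalIntegral.integral_mono_on hab (Continuous.intervalIntegrable (by fun_prop) _ _)
      (Continuous.intervalIntegrable (by fun_prop) _ _) h1
  refine h2.trans ?_
  rw [intervalIntegral.integral_const_mul]
  gcongr
  refine le_min ?_ ?_
  · have h3 : ∫ u in a..b, Real.exp (-((b - u) * μ)) ≤ ∫ _ in a..b, (1 : ℝ) :=
      intervalIntegral.integral_mono_on hab (Continuous.intervalIntegrable (by fun_prop) _ _)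
        (Continuous.intervalIntegrable (by fun_prop) _ _) fun u hu => by
          rw [Real.exp_le_one_iff]
          nlinarith [mul_nonneg (sub_nonneg.mpr hu.2) hμ.le]
    simpa using h3
  · have h3 : ∫ u in a..b, Real.exp (-((b - u) * μ)) =
        μ⁻¹ * Real.exp (-((b - b) * μ)) - μ⁻¹ * Real.exp (-((b - a) * μ)) := by
      refine intervalIntegral.integral_eq_sub_of_hasDerivAt (f := fun u =>
        μ⁻¹ * Real.exp (-((b - u) * μ))) (fun u _ => ?_)
        (Continuous.intervalIntegrable (by fun_prop) _ _)
      have h4 : HasDerivAt (fun u => -((b - u) * μ)) μ u := by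
        have := (((hasDerivAt_id' u).const_sub b).mul_const μ).fun_neg
        rwa [neg_one_mul, neg_neg] at this
      have := (h4.exp).const_mul μ⁻¹
      rwa [mul_comm (Real.exp _) μ, inv_mul_cancel_left₀ hμ.ne'] at this
    rw [h3]
    have : 0 ≤ μ⁻¹ * Real.exp (-((b - a) * μ)) := by positivity
    simp only [sub_self, zero_mul, neg_zero, Real.exp_zero, mul_one]
    linarith

/-- For `lam ≤ 0` use `1 - e^x ≤ -x`; for `0 ≤ lam ≤ 1` use `e^x - 1 ≤ x e^x` and `lam ≤ 2 - lam`.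
The minimum is at most `1`, so its square can be replaced by itself. -/
theorem sq_exp_sub_one_le {lam T h : ℝ} (hl : lam ≤ 1) (h0 : 0 ≤ h) (hT : h ≤ T) :
    (Real.exp (h * lam) - 1) ^ 2 ≤ Real.exp (2 * T) * min 1 (h * (2 - lam)) := by
  have hT0 : 0 ≤ T := h0.trans hT
  have he : 1 ≤ Real.exp T := Real.one_le_exp hT0
  have hm : 0 ≤ min 1 (h * (2 - lam)) := le_min zero_le_one (mul_nonneg h0 (by linarith))
  have key : |Real.exp (h * lam) - 1| ≤ Real.exp T * min 1 (h * (2 - lam)) := by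
    rw [mul_min_of_nonneg _ _ (by positivity), mul_one]
    rcases le_total lam 0 with hlam | hlam
    · have h1 : Real.exp (h * lam) ≤ 1 := Real.exp_le_one_iff.mpr (by nlinarith)
      have h2 := Real.add_one_le_exp (h * lam)
      have h3 := Real.exp_pos (h * lam)
      rw [abs_of_nonpos (by linarith)]
      refine le_min (by linarith) ?_
      have h4 : 0 ≤ h * (2 - lam) := mul_nonneg h0 (by linarith)
      nlinarith
    · have h1 : 1 ≤ Real.exp (h * lam) := Real.one_le_exp (by positivity)
      have h2 : Real.exp (h * lam) ≤ Real.exp T := Real.exp_le_exp.mpr (by nlinarith)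
      have h3 := Real.add_one_le_exp (-(h * lam))
      have h4 : Real.exp (-(h * lam)) * Real.exp (h * lam) = 1 := by
        rw [← Real.exp_add]; simp
      rw [abs_of_nonneg (by linarith)]
      refine le_min (by linarith) ?_
      have h5 : Real.exp (h * lam) - 1 ≤ h * lam * Real.exp (h * lam) := by nlinarith
      have h6 : h * lam * Real.exp (h * lam) ≤ h * lam * Real.exp T := by gcongr
      have h7 : h * lam * Real.exp T ≤ h * (2 - lam) * Real.exp T := by
        gcongr; linarith
      linarith
  calc (Real.exp (h * lam) - 1) ^ 2 = |Real.exp (h * lam) - 1| ^ 2 := (sq_abs _).symm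
    _ ≤ (Real.exp T * min 1 (h * (2 - lam))) ^ 2 := by gcongr
    _ = Real.exp (2 * T) * (min 1 (h * (2 - lam))) ^ 2 := by
        rw [mul_pow, ← Real.exp_nat_mul]; norm_num
    _ ≤ _ := by
        gcongr
        nlinarith [min_le_left 1 (h * (2 - lam))]

/-- The integrand `u ↦ 1_{(0,t]}(u) e^{(t-u)λ}` of the stochastic convolution. -/
def convIntegrand (lam : ℝ) (t : ℝ≥0) : ℝ → ℝ :=
  (Ioc (0 : ℝ) t).indicator fun u => Real.exp (((t : ℝ) - u) * lam)

/-- On `(0,s]` the difference is `(e^{h lam} - 1) e^{(s-u) lam}`, while on `(s,t]` only the later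
integrand survives. With `μ = 2 - lam`, the old noise contributes `(h^γ μ^γ) · μ⁻¹`, the new noise
`min(h, μ⁻¹) ≤ h^γ μ^(γ-1)`: the same order, hence the factor `2`. The exponent `6T` is `2T + 4T`.
-/
theorem integral_sq_convIntegrand_sub_le {lam γ : ℝ} (hl : lam ≤ 1) (h0 : 0 ≤ γ) (h1 : γ ≤ 1)
    {T s t : ℝ≥0} (hst : s ≤ t) (ht : t ≤ T) :
    ∫ u, (convIntegrand lam t u - convIntegrand lam s u) ^ 2 ≤
      2 * Real.exp (6 * T) * ((t : ℝ) - s) ^ γ * (2 - lam) ^ (γ - 1) := by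
  have hμ : 0 < 2 - lam := by linarith
  have hst' : (s : ℝ) ≤ t := hst
  have ht' : (t : ℝ) ≤ T := ht
  have hs0 : (0 : ℝ) ≤ s := s.coe_nonneg
  set h := (t : ℝ) - s with hh
  have hh0 : 0 ≤ h := sub_nonneg.mpr hst'
  have e0 : (fun u => (convIntegrand lam t u - convIntegrand lam s u) ^ 2) = fun u =>
      (Ioc (0 : ℝ) s).indicator (fun u => (Real.exp (h * lam) - 1) ^ 2 *
        Real.exp (((s : ℝ) - u) * lam) ^ 2) u +
      (Ioc (s : ℝ) t).indicator (fun u => Real.exp (((t : ℝ) - u) * lam) ^ 2) u := by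
    ext u
    have e1 : Real.exp (((t : ℝ) - u) * lam) =
        Real.exp (h * lam) * Real.exp (((s : ℝ) - u) * lam) := by
      rw [← Real.exp_add]; congr 1; rw [hh]; ring
    unfold convIntegrand
    rcases le_or_gt u 0 with h0u | h0u
    · have : u ≤ s := h0u.trans hs0
      simp [indicator, h0u.not_gt, this.not_gt]
    rcases le_or_gt u s with hsu | hsu
    · simp only [indicator, mem_Ioc, h0u, hsu, hsu.trans hst', hsu.not_gt, true_and, false_and,
        if_true, if_false, e1]
      ring
    · simp [indicator, h0u, hsu, hsu.not_ge]
  rw [e0, integral_add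
    ((Continuous.integrableOn_Ioc (by fun_prop)).integrable_indicator measurableSet_Ioc)
    ((Continuous.integrableOn_Ioc (by fun_prop)).integrable_indicator measurableSet_Ioc),
    integral_indicator measurableSet_Ioc, integral_indicator measurableSet_Ioc,
    ← intervalIntegral.integral_of_le hs0, ← intervalIntegral.integral_of_le hst',
    intervalIntegral.integral_const_mul]
  have i1 := integral_exp_le (T := (T : ℝ)) hl hs0 (by linarith)
  have i2 := integral_exp_le (T := (T : ℝ)) hl hst' (by linarith)
  have i3 := sq_exp_sub_one_le (T := (T : ℝ)) hl hh0 (by linarith)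
  have m1 : min (h : ℝ) (2 - lam)⁻¹ ≤ h ^ γ * (2 - lam) ^ (γ - 1) := by
    refine (min_le_rpow_mul_rpow hh0 (by positivity) h0 h1).trans_eq ?_
    rw [Real.inv_rpow hμ.le, ← Real.rpow_neg hμ.le]; congr 2; ring
  have m2 : min 1 (h * (2 - lam)) ≤ h ^ γ * (2 - lam) ^ γ := by
    rw [min_comm]
    refine (min_le_rpow_mul_rpow (by positivity) zero_le_one h0 h1).trans_eq ?_
    rw [Real.one_rpow, mul_one, Real.mul_rpow hh0 hμ.le]
  have m3 : min ((s : ℝ) - 0) (2 - lam)⁻¹ ≤ (2 - lam)⁻¹ := min_le_right _ _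
  have hp : 0 ≤ h ^ γ * (2 - lam) ^ (γ - 1) := by positivity
  have f1 : (Real.exp (h * lam) - 1) ^ 2 * ∫ u in (0 : ℝ)..s, Real.exp (((s : ℝ) - u) * lam) ^ 2 ≤
      Real.exp (6 * T) * (h ^ γ * (2 - lam) ^ (γ - 1)) := by
    calc _ ≤ (Real.exp (2 * T) * (h ^ γ * (2 - lam) ^ γ)) * (Real.exp (4 * T) * (2 - lam)⁻¹) := by
          refine mul_le_mul (i3.trans (by gcongr)) (i1.trans (by gcongr)) ?_ (by positivity)
          exact intervalIntegral.integral_nonneg hs0 fun u _ => by positivity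
      _ = (Real.exp (2 * T) * Real.exp (4 * T)) * (h ^ γ * ((2 - lam) ^ γ * (2 - lam)⁻¹)) := by ring
      _ = _ := by
          rw [← Real.exp_add, Real.rpow_sub_one hμ.ne', div_eq_mul_inv]
          congr 2; ring
  have f2 : ∫ u in (s : ℝ)..t, Real.exp (((t : ℝ) - u) * lam) ^ 2 ≤
      Real.exp (6 * T) * (h ^ γ * (2 - lam) ^ (γ - 1)) := by
    refine i2.trans (mul_le_mul (Real.exp_le_exp.mpr ?_) m1 (le_min hh0 (by positivity))
      (by positivity))
    have := T.coe_nonneg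
    linarith
  linarith

theorem norm_sq_toLp_sub {f g : ℝ → ℝ} (hf : MemLp f 2 volume) (hg : MemLp g 2 volume) :
    ‖hf.toLp - hg.toLp‖ ^ 2 = ∫ u, (f u - g u) ^ 2 := by
  rw [← MemLp.toLp_sub, ← real_inner_self_eq_norm_sq, L2.inner_def]
  refine integral_congr_ae ?_
  filter_upwards [(hf.sub hg).coeFn_toLp] with u hu
  rw [hu]
  simp [sq]

end Eigenvalues

/-! ### Kolmogorov's continuity theorem on an interval -/

section DyadicHolder

variable {E : Type*} [NormedAddCommGroup E] {g : ℕ → ℕ → E} {A r : ℝ}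

/-- Given the values `g n k` of a path at the dyadic points `k / 2^n`, its `n`-th dyadic
approximation at `x`. -/
def dyadicApprox (g : ℕ → ℕ → E) (n : ℕ) (x : ℝ) : E := g n ⌊2 ^ n * x⌋₊

/-- If `k` is the floor of `2^n x`, the floor at the next level is `2k` or `2k + 1`. Thus
consecutive approximations coincide or differ by one increment of level `n + 1`. -/
theorem dist_dyadicApprox_succ_le (hA : 0 ≤ A) (hr0 : 0 ≤ r) (hr1 : r ≤ 1)
    (hsub : ∀ n k, g (n + 1) (2 * k) = g n k)
    (hinc : ∀ n, ∀ k < 2 ^ n, ‖g n (k + 1) - g n k‖ ≤ A * r ^ n)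
    {x : ℝ} (hx : x ∈ Icc (0 : ℝ) 1) (n : ℕ) :
    dist (dyadicApprox g n x) (dyadicApprox g (n + 1) x) ≤ A * r ^ n := by
  unfold dyadicApprox
  set k := ⌊2 ^ n * x⌋₊ with hk
  have hx0 : 0 ≤ 2 ^ n * x := mul_nonneg (by positivity) hx.1
  have h1 : (k : ℝ) ≤ 2 ^ n * x := Nat.floor_le hx0
  have h2 : 2 ^ n * x < k + 1 := Nat.lt_floor_add_one _
  have hx0' : 0 ≤ 2 ^ (n + 1) * x := mul_nonneg (by positivity) hx.1
  have h3 : (⌊2 ^ (n + 1) * x⌋₊ : ℝ) ≤ 2 ^ (n + 1) * x := Nat.floor_le hx0'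
  have h4 : 2 ^ (n + 1) * x < ⌊2 ^ (n + 1) * x⌋₊ + 1 := Nat.lt_floor_add_one _
  have h5 : 2 ^ (n + 1) * x = 2 * (2 ^ n * x) := by ring
  have h6 : 2 * k ≤ ⌊2 ^ (n + 1) * x⌋₊ := by
    refine Nat.le_floor ?_
    push_cast; linarith
  have h7 : ⌊2 ^ (n + 1) * x⌋₊ < 2 * k + 2 := by
    have : (⌊2 ^ (n + 1) * x⌋₊ : ℝ) < 2 * k + 2 := by linarith
    exact_mod_cast this
  have h8 : 0 ≤ A * r ^ n := by positivity
  rcases (by omega : ⌊2 ^ (n + 1) * x⌋₊ = 2 * k ∨ ⌊2 ^ (n + 1) * x⌋₊ = 2 * k + 1) with h | h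
  · rw [h, hsub, dist_self]; exact h8
  · rw [h, ← hsub n k, dist_comm, dist_eq_norm]
    -- The increment stays inside the unit interval even for `x = 1`, since the odd index `2k + 1`
    -- is at most `2^(n+1)`.
    have h9 : 2 * k < 2 ^ (n + 1) := by
      have : ((2 * k + 1 : ℕ) : ℝ) ≤ 2 ^ (n + 1) := by
        rw [← h]; exact h3.trans (mul_le_of_le_one_right (by positivity) hx.2)
      have : 2 * k + 1 ≤ 2 ^ (n + 1) := by exact_mod_cast this
      omega
    refine (hinc (n + 1) (2 * k) h9).trans ?_
    rw [pow_succ, ← mul_assoc]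
    exact mul_le_of_le_one_right h8 hr1

/-- Points at distance at most `2^(-n)` have floors at level `n` that differ by at most one. -/
theorem dist_dyadicApprox_le (hA : 0 ≤ A) (hr0 : 0 ≤ r)
    (hinc : ∀ n, ∀ k < 2 ^ n, ‖g n (k + 1) - g n k‖ ≤ A * r ^ n)
    {x y : ℝ} (hx : x ∈ Icc (0 : ℝ) 1) (hy : y ∈ Icc (0 : ℝ) 1) {n : ℕ}
    (hxy : |x - y| ≤ (1 / 2) ^ n) :
    dist (dyadicApprox g n x) (dyadicApprox g n y) ≤ A * r ^ n := by
  wlog hle : x ≤ y generalizing x y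
  · rw [dist_comm]
    exact this hy hx (by rwa [abs_sub_comm]) (le_of_not_ge hle)
  unfold dyadicApprox
  have h0 : (0 : ℝ) < 2 ^ n := by positivity
  have h1 : ⌊2 ^ n * x⌋₊ ≤ ⌊2 ^ n * y⌋₊ := Nat.floor_le_floor (by gcongr)
  have h2 : 2 ^ n * y ≤ 2 ^ n * x + 1 := by
    rw [abs_sub_comm, abs_of_nonneg (by linarith), one_div, inv_pow] at hxy
    have := mul_le_mul_of_nonneg_left hxy h0.le
    rw [mul_inv_cancel₀ h0.ne'] at this
    linarith
  have h3 : ⌊2 ^ n * y⌋₊ ≤ ⌊2 ^ n * x⌋₊ + 1 := by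
    rw [← Nat.floor_add_one (mul_nonneg h0.le hx.1)]
    exact Nat.floor_le_floor h2
  rcases (by omega : ⌊2 ^ n * y⌋₊ = ⌊2 ^ n * x⌋₊ ∨ ⌊2 ^ n * y⌋₊ = ⌊2 ^ n * x⌋₊ + 1) with h | h
  · rw [h, dist_self]; positivity
  · rw [h, dist_comm, dist_eq_norm]
    refine hinc n _ ?_
    have h4 : (⌊2 ^ n * y⌋₊ : ℝ) ≤ 2 ^ n * y := Nat.floor_le (mul_nonneg h0.le hy.1)
    have h5 : (⌊2 ^ n * y⌋₊ : ℝ) ≤ 2 ^ n := h4.trans (mul_le_of_le_one_right h0.le hy.2)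
    have h6 : ⌊2 ^ n * y⌋₊ ≤ 2 ^ n := by exact_mod_cast h5
    omega

/-- The constant of the Hölder estimate obtained by dyadic chaining. -/
def chainingConst (α : ℝ) : ℝ := (2 / (1 - 2 ^ (-α)) + 1) * 2 ^ α

theorem two_rpow_neg_lt_one {α : ℝ} (hα : 0 < α) : (2 : ℝ) ^ (-α) < 1 :=
  Real.rpow_lt_one_of_one_lt_of_neg (by norm_num) (by linarith)

theorem chainingConst_pos {α : ℝ} (hα : 0 < α) : 0 < chainingConst α := by
  have := two_rpow_neg_lt_one hα
  have : 0 < 1 - (2 : ℝ) ^ (-α) := by linarith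
  unfold chainingConst; positivity

variable [CompleteSpace E] {α : ℝ}

theorem exists_tendsto_dyadicApprox (hα : 0 < α) (hA : 0 ≤ A)
    (hsub : ∀ n k, g (n + 1) (2 * k) = g n k)
    (hinc : ∀ n, ∀ k < 2 ^ n, ‖g n (k + 1) - g n k‖ ≤ A * ((2 : ℝ) ^ (-α)) ^ n)
    {x : ℝ} (hx : x ∈ Icc (0 : ℝ) 1) :
    ∃ y, Tendsto (fun n => dyadicApprox g n x) atTop (𝓝 y) :=
  cauchySeq_tendsto_of_complete (cauchySeq_of_le_geometric _ A (two_rpow_neg_lt_one hα)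
    (dist_dyadicApprox_succ_le hA (by positivity) (two_rpow_neg_lt_one hα).le hsub hinc hx))

-- Chaining: choose `n` with `2^(-n-1) < |x - y| ≤ 2^(-n)`, go from `a` to the `n`-th approximation
-- at `x`, across to that at `y`, and on to `b`. The two geometric tails and the crossing give `2/(1
-- - r) + 1`; the remaining factor `2^α` of `chainingConst` is lost in comparing `2^(-n)` with `|x -
-- y|`.
omit [CompleteSpace E] in
theorem dist_le_of_tendsto_dyadicApprox (hα : 0 < α) (hA : 0 ≤ A)
    (hsub : ∀ n k, g (n + 1) (2 * k) = g n k)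
    (hinc : ∀ n, ∀ k < 2 ^ n, ‖g n (k + 1) - g n k‖ ≤ A * ((2 : ℝ) ^ (-α)) ^ n)
    {x y : ℝ} (hx : x ∈ Icc (0 : ℝ) 1) (hy : y ∈ Icc (0 : ℝ) 1) {a b : E}
    (ha : Tendsto (fun n => dyadicApprox g n x) atTop (𝓝 a))
    (hb : Tendsto (fun n => dyadicApprox g n y) atTop (𝓝 b)) :
    dist a b ≤ A * chainingConst α * |x - y| ^ α := by
  set r := (2 : ℝ) ^ (-α) with hr
  have hr0 : 0 < r := by positivity
  have hr1 : r < 1 := two_rpow_neg_lt_one hα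
  have hr1' : 0 < 1 - r := by linarith
  rcases eq_or_ne x y with rfl | hne
  · rw [tendsto_nhds_unique ha hb, dist_self]
    have := chainingConst_pos hα
    positivity
  have hpos : 0 < |x - y| := abs_pos.mpr (sub_ne_zero.mpr hne)
  have hle1 : |x - y| ≤ 1 := by
    rw [abs_le]; constructor <;> linarith [hx.1, hx.2, hy.1, hy.2]
  obtain ⟨n, hn1, hn2⟩ := exists_nat_pow_near_of_lt_one hpos hle1
    (show (0 : ℝ) < 1 / 2 by norm_num) (by norm_num)
  have h1 := dist_le_of_le_geometric_of_tendsto r A hr1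
    (dist_dyadicApprox_succ_le hA hr0.le hr1.le hsub hinc hx) ha n
  have h2 := dist_le_of_le_geometric_of_tendsto r A hr1
    (dist_dyadicApprox_succ_le hA hr0.le hr1.le hsub hinc hy) hb n
  have h3 := dist_dyadicApprox_le hA hr0.le hinc hx hy hn2
  have h4 : dist a b ≤ A * r ^ n * (2 / (1 - r) + 1) := by
    have h5 := dist_triangle4 a (dyadicApprox g n x) (dyadicApprox g n y) b
    rw [dist_comm a (dyadicApprox g n x)] at h5
    have : A * r ^ n * (2 / (1 - r) + 1) = A * r ^ n / (1 - r) + A * r ^ n +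
      A * r ^ n / (1 - r) := by ring
    linarith
  have h5 : r ^ n ≤ 2 ^ α * |x - y| ^ α := by
    have h6 : r ^ n = 2 ^ α * ((1 / 2 : ℝ) ^ (n + 1)) ^ α := by
      rw [hr, ← Real.rpow_natCast, ← Real.rpow_natCast, one_div, Real.inv_rpow (by norm_num),
        ← Real.rpow_neg (by norm_num), ← Real.rpow_mul (by norm_num), ← Real.rpow_mul (by norm_num),
        ← Real.rpow_add (by norm_num)]
      congr 1
      push_cast; ring
    rw [h6]
    gcongr
  calc dist a b ≤ A * r ^ n * (2 / (1 - r) + 1) := h4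
    _ ≤ A * (2 ^ α * |x - y| ^ α) * (2 / (1 - r) + 1) := by gcongr
    _ = _ := by unfold chainingConst; ring

end DyadicHolder

/-! ### Moments of dyadic increments and construction of the modification. -/

section Kolmogorov

variable {Ω : Type*} [MeasurableSpace Ω] {P : Measure Ω}
  {E : Type*} [NormedAddCommGroup E]

/-- The point `T k / 2^n`. -/
def dyadicTime (T : ℝ≥0) (n k : ℕ) : ℝ≥0 := T * (k / 2 ^ n)

theorem dyadicTime_succ_two_mul (T : ℝ≥0) (n k : ℕ) :
    dyadicTime T (n + 1) (2 * k) = dyadicTime T n k := by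
  unfold dyadicTime
  congr 1
  rw [pow_succ']
  push_cast
  exact mul_div_mul_left _ _ two_ne_zero

theorem dyadicTime_le (T : ℝ≥0) {n k : ℕ} (hk : k ≤ 2 ^ n) : dyadicTime T n k ≤ T := by
  refine mul_le_of_le_one_right (by positivity) (div_le_one_of_le₀ ?_ (by positivity))
  exact_mod_cast hk

theorem abs_dyadicTime_succ_sub (T : ℝ≥0) (n k : ℕ) :
    |(dyadicTime T n (k + 1) : ℝ) - dyadicTime T n k| = T / 2 ^ n := by
  unfold dyadicTime
  push_cast
  rw [show (T : ℝ) * ((k + 1) / 2 ^ n) - T * (k / 2 ^ n) = T / 2 ^ n by ring]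
  exact abs_of_nonneg (by positivity)

/-- The functional `∑ₙ 2^{αqn} ∑ₖ ‖V(t_{k+1}) - V(t_k)‖^q` of the dyadic increments. -/
def dyadicVariation (V : ℝ≥0 → Ω → E) (T : ℝ≥0) (α q : ℝ) (ω : Ω) : ℝ≥0∞ :=
  ∑' n : ℕ, ENNReal.ofReal (2 ^ (α * q * n)) * ∑ k ∈ Finset.range (2 ^ n),
    ‖V (dyadicTime T n (k + 1)) ω - V (dyadicTime T n k) ω‖ₑ ^ q

theorem measurable_dyadicVariation {V : ℝ≥0 → Ω → E} (hV : ∀ t, StronglyMeasurable (V t))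
    (T : ℝ≥0) (α q : ℝ) : Measurable (dyadicVariation V T α q) := by
  refine Measurable.tsum fun n => Measurable.const_mul ?_ _
  exact Finset.measurable_sum _ fun k _ => (((hV _).sub (hV _)).enorm).pow_const q

/-- A bound of the mean of `dyadicVariation`. -/
def dyadicVariationBound (C T : ℝ≥0) (α q b : ℝ) : ℝ≥0∞ :=
  C * ENNReal.ofReal ((T : ℝ) ^ b) * (1 - ENNReal.ofReal (2 ^ (α * q + 1 - b)))⁻¹

theorem dyadicVariationBound_ne_top (C T : ℝ≥0) {α q b : ℝ} (h : α * q + 1 < b) :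
    dyadicVariationBound C T α q b ≠ ∞ := by
  refine ENNReal.mul_ne_top (ENNReal.mul_ne_top (by simp) (by simp)) (ENNReal.inv_ne_top.mpr ?_)
  refine (tsub_pos_of_lt ?_).ne'
  rw [← ENNReal.ofReal_one]
  exact (ENNReal.ofReal_lt_ofReal_iff one_pos).mpr
    (Real.rpow_lt_one_of_one_lt_of_neg (by norm_num) (by linarith))

/-- Level `n` has `2^n` increments of mean at most `C (T/2^n)^b` and weight `2^(αqn)`, so it
contributes `C T^b 2^{(αq+1-b)n}`, a term of a geometric series. -/
theorem lintegral_dyadicVariation_le {V : ℝ≥0 → Ω → E} (hV : ∀ t, StronglyMeasurable (V t))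
    {C T : ℝ≥0} {α q b : ℝ}
    (hinc : ∀ s ≤ T, ∀ t ≤ T,
      ∫⁻ ω, ‖V t ω - V s ω‖ₑ ^ q ∂P ≤ C * ENNReal.ofReal (|(t : ℝ) - s| ^ b)) :
    ∫⁻ ω, dyadicVariation V T α q ω ∂P ≤ dyadicVariationBound C T α q b := by
  have hm : ∀ n k, Measurable fun ω =>
      ‖V (dyadicTime T n (k + 1)) ω - V (dyadicTime T n k) ω‖ₑ ^ q := fun n k =>
    (((hV _).sub (hV _)).enorm).pow_const q
  unfold dyadicVariation
  rw [lintegral_tsum fun n =>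
    ((Finset.measurable_sum _ fun k _ => hm n k).const_mul _).aemeasurable]
  unfold dyadicVariationBound
  rw [← ENNReal.tsum_geometric, ← ENNReal.tsum_mul_left]
  refine ENNReal.tsum_le_tsum fun n => ?_
  rw [lintegral_const_mul _ (Finset.measurable_sum _ fun k _ => hm n k),
    lintegral_finsetSum _ fun k _ => hm n k]
  have h1 : ∑ k ∈ Finset.range (2 ^ n), ∫⁻ ω,
      ‖V (dyadicTime T n (k + 1)) ω - V (dyadicTime T n k) ω‖ₑ ^ q ∂P ≤
      (2 ^ n : ℕ) • (C * ENNReal.ofReal ((T / 2 ^ n : ℝ) ^ b)) := by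
    refine (Finset.sum_le_card_nsmul _ _ (C * ENNReal.ofReal ((T / 2 ^ n : ℝ) ^ b))
      fun k hk => ?_).trans_eq (by rw [Finset.card_range])
    rw [Finset.mem_range] at hk
    refine (hinc _ (dyadicTime_le T hk.le) _ (dyadicTime_le T hk)).trans_eq ?_
    rw [abs_dyadicTime_succ_sub]
  refine (mul_le_mul_right h1 _).trans_eq ?_
  rw [nsmul_eq_mul, ← ENNReal.ofReal_natCast, ← ENNReal.ofReal_pow (by positivity)]
  have h2 : ∀ x y z w : ℝ≥0∞, x * (y * (z * w)) = z * (x * y * w) := fun x y z w => by ring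
  rw [h2, mul_assoc (C : ℝ≥0∞)]
  congr 1
  rw [← ENNReal.ofReal_mul (by positivity), ← ENNReal.ofReal_mul (by positivity),
    ← ENNReal.ofReal_mul (by positivity)]
  congr 1
  rw [Real.div_rpow (by positivity) (by positivity), ← Real.rpow_natCast _ n,
    ← Real.rpow_natCast _ n, ← Real.rpow_mul (by positivity), ← Real.rpow_mul (by positivity),
    div_eq_mul_inv, ← Real.rpow_neg (by positivity)]
  push_cast
  rw [← Real.rpow_natCast, ← Real.rpow_add (by norm_num), mul_left_comm,
    ← Real.rpow_add (by norm_num)]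
  congr 2
  ring

-- A single term of a series of nonnegative terms is at most its sum; taking `q`-th roots gives the
-- geometric bound that chaining needs.
omit [MeasurableSpace Ω] in
theorem norm_sub_le_of_dyadicVariation {V : ℝ≥0 → Ω → E} {T : ℝ≥0} {α q : ℝ} (hq : 0 < q) {ω : Ω}
    (h : dyadicVariation V T α q ω ≠ ∞) {n k : ℕ} (hk : k < 2 ^ n) :
    ‖V (dyadicTime T n (k + 1)) ω - V (dyadicTime T n k) ω‖ ≤
      (dyadicVariation V T α q ω).toReal ^ q⁻¹ * ((2 : ℝ) ^ (-α)) ^ n := by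
  set x := ‖V (dyadicTime T n (k + 1)) ω - V (dyadicTime T n k) ω‖ with hx
  have hx0 : 0 ≤ x := norm_nonneg _
  have h1 : ENNReal.ofReal (2 ^ (α * q * n) * x ^ q) ≤ dyadicVariation V T α q ω := by
    rw [ENNReal.ofReal_mul (by positivity), ← ENNReal.ofReal_rpow_of_nonneg hx0 hq.le, hx,
      ofReal_norm]
    refine le_trans ?_ (ENNReal.le_tsum n)
    gcongr
    exact Finset.single_le_sum (f := fun k =>
      ‖V (dyadicTime T n (k + 1)) ω - V (dyadicTime T n k) ω‖ₑ ^ q) (fun _ _ => zero_le)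
      (Finset.mem_range.mpr hk)
  have h2 := (ENNReal.ofReal_le_iff_le_toReal h).mp h1
  have h3 : 2 ^ (α * n) * x ≤ (dyadicVariation V T α q ω).toReal ^ q⁻¹ := by
    refine (Real.rpow_le_rpow_iff (by positivity) (by positivity) hq).mp ?_
    rw [← Real.rpow_mul (by positivity), inv_mul_cancel₀ hq.ne', Real.rpow_one,
      Real.mul_rpow (by positivity) hx0, ← Real.rpow_mul (by norm_num)]
    convert h2 using 3
    ring
  have h4 : ((2 : ℝ) ^ (-α)) ^ n = (2 ^ (α * n))⁻¹ := by
    rw [← Real.rpow_natCast, ← Real.rpow_mul (by norm_num), ← Real.rpow_neg (by norm_num)]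
    congr 1; ring
  rw [h4, ← div_eq_mul_inv, le_div_iff₀ (by positivity)]
  linarith

variable [CompleteSpace E]

/-- Kolmogorov's continuity theorem on `[0,T]`, with a bound of the mean of the oscillation. -/
theorem exists_holder_modification {V : ℝ≥0 → Ω → E} (hV : ∀ t, StronglyMeasurable (V t))
    {C T : ℝ≥0} (hT : 0 < T) {α q b : ℝ} (hα : 0 < α) (hq : 1 ≤ q) (hb : α * q + 1 < b)
    [IsProbabilityMeasure P]
    (hinc : ∀ s ≤ T, ∀ t ≤ T,
      ∫⁻ ω, ‖V t ω - V s ω‖ₑ ^ q ∂P ≤ C * ENNReal.ofReal (|(t : ℝ) - s| ^ b)) :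
    ∃ Y : ℝ≥0 → Ω → E, (∀ t ≤ T, StronglyMeasurable (Y t)) ∧ (∀ t ≤ T, Y t =ᵐ[P] V t) ∧
      (∀ ω, ∃ K : ℝ, ∀ t ≤ T, ∀ t' ≤ T, ‖Y t ω - Y t' ω‖ ≤ K * |(t : ℝ) - t'| ^ α) ∧
      ∃ N : Ω → ℝ≥0∞, (∀ t ≤ T, ∀ ω, ‖Y t ω - Y 0 ω‖ₑ ≤ N ω) ∧
        ∫⁻ ω, N ω ∂P ≤
          ENNReal.ofReal (chainingConst α) * (1 + dyadicVariationBound C T α q b) := by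
  have hq0 : 0 < q := by linarith
  have hT' : (0 : ℝ) < T := hT
  set D := dyadicVariation V T α q with hD
  have hDm : Measurable D := measurable_dyadicVariation hV T α q
  have hDint := lintegral_dyadicVariation_le (α := α) hV hinc
  have hDae : ∀ᵐ ω ∂P, D ω ≠ ∞ := by
    filter_upwards [ae_lt_top hDm (hDint.trans_lt
      (dyadicVariationBound_ne_top C T hb).lt_top).ne] with ω h using h.ne
  let g : Ω → ℕ → ℕ → E := fun ω n k => V (dyadicTime T n k) ω
  have hsub : ∀ ω n k, g ω (n + 1) (2 * k) = g ω n k := fun ω n k => by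
    simp only [g, dyadicTime_succ_two_mul]
  let A : Ω → ℝ := fun ω => (D ω).toReal ^ q⁻¹
  have hA : ∀ ω, 0 ≤ A ω := fun ω => by positivity
  have hginc : ∀ ω, D ω ≠ ∞ → ∀ n, ∀ k < 2 ^ n,
      ‖g ω n (k + 1) - g ω n k‖ ≤ A ω * ((2 : ℝ) ^ (-α)) ^ n := fun ω h n k hk =>
    norm_sub_le_of_dyadicVariation hq0 h hk
  have hx : ∀ t ≤ T, ((t : ℝ) / T) ∈ Icc (0 : ℝ) 1 := fun t ht =>
    ⟨by positivity, div_le_one_of_le₀ ht hT'.le⟩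
  have hlim : ∀ t ≤ T, ∀ ω, D ω ≠ ∞ → Tendsto (fun n => dyadicApprox (g ω) n (t / T)) atTop
      (𝓝 (limUnder atTop fun n => dyadicApprox (g ω) n (t / T))) := fun t ht ω h =>
    tendsto_nhds_limUnder (exists_tendsto_dyadicApprox hα (hA ω) (hsub ω) (hginc ω h) (hx t ht))
  classical
  -- The value `0` on the null set where the variation is infinite makes every path Hölder, not only
  -- almost every one.
  let Y : ℝ≥0 → Ω → E := fun t ω =>
    if D ω ≠ ∞ then limUnder atTop fun n => dyadicApprox (g ω) n (t / T) else 0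
  have hhol : ∀ ω, ∀ t ≤ T, ∀ t' ≤ T,
      ‖Y t ω - Y t' ω‖ ≤ A ω * chainingConst α * |(t : ℝ) / T - t' / T| ^ α := by
    intro ω t ht t' ht'
    by_cases h : D ω ≠ ∞
    · simp only [Y, if_pos h, ← dist_eq_norm]
      exact dist_le_of_tendsto_dyadicApprox hα (hA ω) (hsub ω) (hginc ω h) (hx t ht) (hx t' ht')
        (hlim t ht ω h) (hlim t' ht' ω h)
    · simp only [Y, if_neg h, sub_self, norm_zero]
      have := chainingConst_pos hα
      have := hA ω
      positivity
  refine ⟨Y, fun t ht => ?_, fun t ht => ?_, fun ω => ?_, ?_⟩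
  · have hset : MeasurableSet {ω | D ω ≠ ∞} := (hDm (measurableSet_singleton ∞)).compl
    refine stronglyMeasurable_of_tendsto atTop (f := fun n => {ω | D ω ≠ ∞}.indicator
      fun ω => dyadicApprox (g ω) n (t / T)) (fun n => (hV _).indicator hset) ?_
    rw [tendsto_pi_nhds]
    intro ω
    by_cases h : D ω ≠ ∞
    · simpa [Y, h] using hlim t ht ω h
    · simp [Y, h]
  -- The `n`-th approximation is `V` at a time within `T/2^n` of `t`, so it converges to `V t` in
  -- `L^q`, while pathwise it converges to `Y t`. An almost surely convergent subsequence identifies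
  -- the limits.
  · have h1 : Tendsto (fun n => eLpNorm ((fun ω => dyadicApprox (g ω) n (t / T)) - V t)
        (ENNReal.ofReal q) P) atTop (𝓝 0) := by
      have h2 : Tendsto (fun n : ℕ => (C * ENNReal.ofReal ((T * (1 / 2 : ℝ) ^ n) ^ b)) ^ (1 / q))
          atTop (𝓝 0) := by
        have hb0 : 0 < b := by have := mul_pos hα hq0; linarith
        have h3 : Tendsto (fun n : ℕ => (T * (1 / 2 : ℝ) ^ n) ^ b) atTop (𝓝 0) := by
          have h4 := (tendsto_pow_atTop_nhds_zero_of_lt_one (r := (1 / 2 : ℝ)) (by norm_num)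
            (by norm_num)).const_mul (T : ℝ)
          rw [mul_zero] at h4
          have h5 := h4.rpow_const (p := b) (Or.inr hb0.le)
          rwa [Real.zero_rpow hb0.ne'] at h5
        have h6 := ENNReal.Tendsto.const_mul (a := (C : ℝ≥0∞))
          ((ENNReal.continuous_ofReal.tendsto 0).comp h3) (Or.inr (by simp))
        rw [ENNReal.ofReal_zero, mul_zero] at h6
        have h7 := h6.ennrpow_const (1 / q)
        rwa [ENNReal.zero_rpow_of_pos (by positivity)] at h7
      refine tendsto_of_tendsto_of_tendsto_of_le_of_le tendsto_const_nhds h2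
        (fun _ => zero_le) fun n => ?_
      rw [eLpNorm_eq_lintegral_rpow_enorm_toReal (by simpa using hq0) (by simp),
        ENNReal.toReal_ofReal hq0.le]
      refine ENNReal.rpow_le_rpow ?_ (by positivity)
      have h0 : (0 : ℝ) < 2 ^ n := by positivity
      set k := ⌊2 ^ n * ((t : ℝ) / T)⌋₊ with hk
      have hk1 : (k : ℝ) ≤ 2 ^ n * (t / T) := Nat.floor_le (mul_nonneg h0.le (hx t ht).1)
      have hk2 : 2 ^ n * ((t : ℝ) / T) < k + 1 := Nat.lt_floor_add_one _
      have hk3 : k ≤ 2 ^ n := by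
        have : (k : ℝ) ≤ 2 ^ n := hk1.trans (mul_le_of_le_one_right h0.le (hx t ht).2)
        exact_mod_cast this
      refine (hinc t ht (dyadicTime T n k) (dyadicTime_le T hk3)).trans ?_
      gcongr
      · have := mul_pos hα hq0; linarith
      have e1 : ((dyadicTime T n k : ℝ≥0) : ℝ) - t = T * (1 / 2) ^ n * (k - 2 ^ n * (t / T)) := by
        unfold dyadicTime
        push_cast
        rw [one_div, inv_pow]
        field_simp
      rw [e1, abs_mul, abs_of_nonneg (by positivity)]
      refine mul_le_of_le_one_right (by positivity) ?_
      rw [abs_le]; constructor <;> linarith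
    have h2 := tendstoInMeasure_of_tendsto_eLpNorm (by simpa using hq0)
      (fun n => (hV _).aestronglyMeasurable) (hV t).aestronglyMeasurable h1
    obtain ⟨ns, hns, hae⟩ := h2.exists_seq_tendsto_ae
    filter_upwards [hae, hDae] with ω h h'
    simp only [Y, if_pos h']
    exact tendsto_nhds_unique ((hlim t ht ω h').comp hns.tendsto_atTop) h
  · refine ⟨A ω * chainingConst α / T ^ α, fun t ht t' ht' => ?_⟩
    refine (hhol ω t ht t' ht').trans_eq ?_
    rw [← sub_div, abs_div, abs_of_pos hT', Real.div_rpow (abs_nonneg _) hT'.le]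
    ring
  · refine ⟨fun ω => ENNReal.ofReal (chainingConst α) * (1 + D ω), fun t ht ω => ?_, ?_⟩
    · have hc := chainingConst_pos hα
      by_cases h : D ω = ∞
      · simp [Y, h]
      have h1 := hhol ω t ht 0 zero_le
      have h2 : |(t : ℝ) / T - ((0 : ℝ≥0) : ℝ) / T| ^ α ≤ 1 := by
        rw [NNReal.coe_zero, zero_div, sub_zero, abs_of_nonneg (hx t ht).1]
        exact Real.rpow_le_one (hx t ht).1 (hx t ht).2 hα.le
      -- As `q ≥ 1`, the root `D^(1/q)` is at most `1 + D`, so the mean of `D` alone controls the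
      -- mean oscillation.
      have h3 : A ω ≤ 1 + (D ω).toReal := by
        rcases le_total (D ω).toReal 1 with h4 | h4
        · have : A ω ≤ 1 := Real.rpow_le_one ENNReal.toReal_nonneg h4 (by positivity)
          have := ENNReal.toReal_nonneg (a := D ω)
          linarith
        · have : A ω ≤ (D ω).toReal := by
            conv_rhs => rw [← Real.rpow_one (D ω).toReal]
            exact Real.rpow_le_rpow_of_exponent_le h4 (inv_le_one_of_one_le₀ hq)
          linarith
      have h4 : ‖Y t ω - Y 0 ω‖ ≤ chainingConst α * (1 + (D ω).toReal) := by
        have := hA ω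
        refine (h1.trans (mul_le_of_le_one_right (by positivity) h2)).trans ?_
        rw [mul_comm]
        gcongr
      rw [← ofReal_norm]
      refine (ENNReal.ofReal_le_ofReal h4).trans_eq ?_
      rw [ENNReal.ofReal_mul hc.le, ENNReal.ofReal_add zero_le_one ENNReal.toReal_nonneg,
        ENNReal.ofReal_toReal h, ENNReal.ofReal_one]
    · rw [lintegral_const_mul _ (by fun_prop), lintegral_add_left measurable_const]
      simp only [lintegral_const, measure_univ, mul_one]
      gcongr

end Kolmogorov

/-! ### Gaussian random series in `L^p(𝕋²)` -/

section RandomSeries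

theorem norm_sum_sq_of_orthogonal {ι H : Type*} [NormedAddCommGroup H] [InnerProductSpace ℝ H]
    (F : Finset ι) {a : ι → H} (ha : ∀ i j, i ≠ j → inner ℝ (a i) (a j) = 0) :
    ‖∑ i ∈ F, a i‖ ^ 2 = ∑ i ∈ F, ‖a i‖ ^ 2 := by
  rw [← real_inner_self_eq_norm_sq, sum_inner]
  refine Finset.sum_congr rfl fun i hi => ?_
  rw [inner_sum, Finset.sum_eq_single i (fun j _ hj => ha i j hj.symm) (fun h => absurd hi h),
    real_inner_self_eq_norm_sq]

/-- The Cauchy criterion passes from the variances `x` to the vectors because the square root is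
continuous at zero; the norm bound survives the limit. -/
theorem summable_and_norm_tsum_le {ι E : Type*} [NormedAddCommGroup E] [CompleteSpace E]
    {f : ι → E} {x : ι → ℝ} (hx : ∀ i, 0 ≤ x i) (hsum : Summable x) {B : ℝ} (hB : 0 ≤ B)
    (h : ∀ F : Finset ι, ‖∑ i ∈ F, f i‖ ≤ B * Real.sqrt (∑ i ∈ F, x i)) :
    Summable f ∧ ‖∑' i, f i‖ ≤ B * Real.sqrt (∑' i, x i) := by
  have hf : Summable f := by
    rw [summable_iff_vanishing_norm]
    intro ε hε
    have hlim : Tendsto (fun y => B * Real.sqrt y) (𝓝 0) (𝓝 0) := by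
      have : Continuous fun y => B * Real.sqrt y := by fun_prop
      simpa using this.tendsto 0
    obtain ⟨δ, hδ, hδε⟩ := Metric.eventually_nhds_iff.mp (hlim.eventually (gt_mem_nhds hε))
    obtain ⟨s, hs⟩ := summable_iff_vanishing_norm.mp hsum δ hδ
    refine ⟨s, fun t ht => (h t).trans_lt (hδε ?_)⟩
    simpa using hs t ht
  refine ⟨hf, le_of_tendsto hf.hasSum.norm (Eventually.of_forall fun F => (h F).trans ?_)⟩
  gcongr
  exact hsum.sum_le_tsum F fun i _ => hx i

variable {L : ℝ} [Fact (0 < 2 * L)] {Ω : Type*} [MeasurableSpace Ω] {P : Measure Ω}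
  {β : ℤ × ℤ → ℝ≥0 → Ω → ℝ}

/-- This is the series at one fixed point of the torus. Its real and imaginary parts lie in the
Gaussian space, and orthogonality bounds their variances by `K² ∑ ‖a_j‖²`. The factor `2` comes from
adding the two parts. -/
theorem eLpNorm_sum_smul_eval_le (hβ : IsIndepBrownianFamily P β) {q : ℝ≥0∞} (hq1 : 1 ≤ q)
    (hq : q ≠ ∞) (F : Finset (ℤ × ℤ)) {a : ℤ × ℤ → gaussianSpace hβ}
    (ha : ∀ i j, i ≠ j → inner ℝ (a i : Lp ℝ 2 P) (a j) = 0) {c : ℤ × ℤ → ℂ} {K : ℝ}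
    (hK : ∀ j, ‖c j‖ ≤ K) :
    eLpNorm (fun ω => ∑ j ∈ F, (((a j : Lp ℝ 2 P) ω : ℝ) : ℂ) * c j) q P ≤
      2 * gaussianMoment q * ENNReal.ofReal (K * Real.sqrt (∑ j ∈ F, ‖(a j : Lp ℝ 2 P)‖ ^ 2)) := by
  have hK0 : 0 ≤ K := (norm_nonneg _).trans (hK 0)
  have hr : ∀ r : ℤ × ℤ → ℝ, (∀ j, |r j| ≤ K) →
      eLpNorm (fun ω => ∑ j ∈ F, (a j : Lp ℝ 2 P) ω * r j) q P ≤
        gaussianMoment q *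
          ENNReal.ofReal (K * Real.sqrt (∑ j ∈ F, ‖(a j : Lp ℝ 2 P)‖ ^ 2)) := by
    intro r hrK
    have h1 : ((∑ j ∈ F, r j • (a j : Lp ℝ 2 P) : Lp ℝ 2 P) : Ω → ℝ) =ᵐ[P]
        fun ω => ∑ j ∈ F, (a j : Lp ℝ 2 P) ω * r j := by
      refine (Lp.coeFn_finsetSum F _).trans ?_
      have h2 : ∀ᵐ ω ∂P, ∀ j ∈ F, (r j • (a j : Lp ℝ 2 P) : Lp ℝ 2 P) ω =
          (a j : Lp ℝ 2 P) ω * r j := by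
        rw [Finset.eventually_all]
        intro j _
        filter_upwards [Lp.coeFn_smul (r j) (a j : Lp ℝ 2 P)] with ω h
        rw [h, Pi.smul_apply, smul_eq_mul, mul_comm]
      filter_upwards [h2] with ω h
      rw [Finset.sum_apply]
      exact Finset.sum_congr rfl h
    rw [← eLpNorm_congr_ae h1]
    refine (eLpNorm_le_of_mem_gaussianSpace hβ
      (Submodule.sum_mem _ fun j _ => Submodule.smul_mem _ _ (a j).2) hq).trans ?_
    gcongr
    rw [← ofReal_norm]
    refine ENNReal.ofReal_le_ofReal ?_
    refine (sq_le_sq₀ (norm_nonneg _) (by positivity)).mp ?_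
    rw [norm_sum_sq_of_orthogonal F fun i j hij => by
        rw [real_inner_smul_left, real_inner_smul_right, ha i j hij, mul_zero, mul_zero],
      mul_pow, Real.sq_sqrt (Finset.sum_nonneg fun _ _ => sq_nonneg _), Finset.mul_sum]
    refine Finset.sum_le_sum fun j _ => ?_
    rw [norm_smul, mul_pow, Real.norm_eq_abs]
    gcongr
    exact hrK j
  have hre := hr (fun j => (c j).re) fun j => (Complex.abs_re_le_norm _).trans (hK j)
  have him := hr (fun j => (c j).im) fun j => (Complex.abs_im_le_norm _).trans (hK j)
  have hm : ∀ r : ℤ × ℤ → ℝ, AEStronglyMeasurable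
      (fun ω => ∑ j ∈ F, (a j : Lp ℝ 2 P) ω * r j) P := fun r => by
    refine (Finset.stronglyMeasurable_fun_sum F fun j _ => ?_).aestronglyMeasurable
    exact (Lp.stronglyMeasurable _).mul_const _
  have hsplit : (fun ω => ∑ j ∈ F, (((a j : Lp ℝ 2 P) ω : ℝ) : ℂ) * c j) =
      (fun ω => ((∑ j ∈ F, (a j : Lp ℝ 2 P) ω * (c j).re : ℝ) : ℂ)) +
      fun ω => Complex.I * ((∑ j ∈ F, (a j : Lp ℝ 2 P) ω * (c j).im : ℝ) : ℂ) := by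
    ext ω
    apply Complex.ext <;> simp
  have hof : ∀ (b : ℂ) (_ : ‖b‖ = 1) (f : Ω → ℝ),
      eLpNorm (fun ω => b * (f ω : ℂ)) q P = eLpNorm f q P := fun b hb f => by
    refine eLpNorm_congr_norm_ae (Eventually.of_forall fun ω => ?_)
    rw [norm_mul, hb, one_mul, Complex.norm_real]
  rw [hsplit, mul_assoc, two_mul]
  refine (eLpNorm_add_le ?_ ?_ hq1).trans (add_le_add ?_ ?_)
  · exact Complex.continuous_ofReal.comp_aestronglyMeasurable (hm _)
  · exact (Complex.continuous_ofReal.comp_aestronglyMeasurable (hm _)).const_mul _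
  · have := hof 1 (by simp) (fun ω => ∑ j ∈ F, (a j : Lp ℝ 2 P) ω * (c j).re)
    simp only [one_mul] at this
    exact this.trans_le hre
  · exact (hof Complex.I (by simp) _).trans_le him

/-- On the probability space `𝕋²` the exponent may be raised from `p` to `q`, which is what allows
Tonelli's theorem with the same exponent on `Ω`. -/
theorem enorm_sum_smul_toLp_le {p q : ℝ≥0∞} [Fact (1 ≤ p)] (hpq : p ≤ q) (F : Finset (ℤ × ℤ))
    (c : ℤ × ℤ → ℂ) (e : ℤ × ℤ → C(Torus L, ℂ)) :
    ‖∑ j ∈ F, c j • ContinuousMap.toLp p (torusMeasure L) ℂ (e j)‖ₑ ≤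
      eLpNorm (fun z => ∑ j ∈ F, c j * e j z) q (torusMeasure L) := by
  have h1 : ∑ j ∈ F, c j • ContinuousMap.toLp p (torusMeasure L) ℂ (e j) =
      ContinuousMap.toLp p (torusMeasure L) ℂ (∑ j ∈ F, c j • e j) := by
    simp only [map_sum, map_smul]
  rw [h1, Lp.enorm_def, eLpNorm_congr_ae (ContinuousMap.coeFn_toLp (torusMeasure L) _)]
  refine (eLpNorm_le_eLpNorm_of_exponent_le hpq
    (ContinuousMap.continuous _).aestronglyMeasurable).trans_eq ?_
  congr 1
  ext z
  simp [ContinuousMap.sum_apply]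

/-- After the spatial exponent is raised to `q`, the order of integration is exchanged and the
scalar Gaussian bound, uniform in `z`, is integrated over a measure of mass one. -/
theorem eLpNorm_sum_smul_toLp_le [IsProbabilityMeasure P] (hβ : IsIndepBrownianFamily P β)
    {p q : ℝ≥0∞} [Fact (1 ≤ p)] (hpq : p ≤ q) (hq : q ≠ ∞) (F : Finset (ℤ × ℤ))
    {a : ℤ × ℤ → gaussianSpace hβ}
    (ha : ∀ i j, i ≠ j → inner ℝ (a i : Lp ℝ 2 P) (a j) = 0) {e : ℤ × ℤ → C(Torus L, ℂ)} {K : ℝ}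
    (hK : ∀ j z, ‖e j z‖ ≤ K) :
    eLpNorm (fun ω => ∑ j ∈ F, (((a j : Lp ℝ 2 P) ω : ℝ) : ℂ) •
        ContinuousMap.toLp p (torusMeasure L) ℂ (e j)) q P ≤
      2 * gaussianMoment q * ENNReal.ofReal (K * Real.sqrt (∑ j ∈ F, ‖(a j : Lp ℝ 2 P)‖ ^ 2)) := by
  have hp1 : 1 ≤ p := Fact.out
  have hq1 : 1 ≤ q := hp1.trans hpq
  have hq0 : q ≠ 0 := (zero_lt_one.trans_le hq1).ne'
  have hqr : 0 < q.toReal := ENNReal.toReal_pos hq0 hq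
  set B := 2 * gaussianMoment q *
    ENNReal.ofReal (K * Real.sqrt (∑ j ∈ F, ‖(a j : Lp ℝ 2 P)‖ ^ 2)) with hB
  have hpt : ∀ z, ∫⁻ ω, ‖∑ j ∈ F, (((a j : Lp ℝ 2 P) ω : ℝ) : ℂ) * e j z‖ₑ ^ q.toReal ∂P ≤
      B ^ q.toReal := fun z => by
    have h := eLpNorm_sum_smul_eval_le hβ hq1 hq F ha (c := fun j => e j z) fun j => hK j z
    rw [eLpNorm_eq_lintegral_rpow_enorm_toReal hq0 hq, one_div] at h
    rw [← ENNReal.rpow_inv_le_iff hqr]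
    exact h
  have hmeas : Measurable (Function.uncurry fun (ω : Ω) (z : Torus L) =>
      ‖∑ j ∈ F, (((a j : Lp ℝ 2 P) ω : ℝ) : ℂ) * e j z‖ₑ ^ q.toReal) := by
    refine Measurable.pow_const (Measurable.enorm (Finset.measurable_fun_sum F fun j _ => ?_)) _
    refine Measurable.mul ?_ ?_
    · exact Complex.measurable_ofReal.comp
        ((Lp.stronglyMeasurable (a j : Lp ℝ 2 P)).measurable.comp measurable_fst)
    · exact (e j).continuous.measurable.comp measurable_snd
  rw [eLpNorm_eq_lintegral_rpow_enorm_toReal hq0 hq, one_div, ENNReal.rpow_inv_le_iff hqr]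
  calc ∫⁻ ω, ‖∑ j ∈ F, (((a j : Lp ℝ 2 P) ω : ℝ) : ℂ) •
        ContinuousMap.toLp p (torusMeasure L) ℂ (e j)‖ₑ ^ q.toReal ∂P
      ≤ ∫⁻ ω, ∫⁻ z, ‖∑ j ∈ F, (((a j : Lp ℝ 2 P) ω : ℝ) : ℂ) * e j z‖ₑ ^ q.toReal
          ∂(torusMeasure L) ∂P := by
        refine lintegral_mono fun ω => ?_
        have h := enorm_sum_smul_toLp_le hpq F (fun j => (((a j : Lp ℝ 2 P) ω : ℝ) : ℂ)) e
        rw [eLpNorm_eq_lintegral_rpow_enorm_toReal hq0 hq, one_div] at h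
        exact (ENNReal.le_rpow_inv_iff hqr).mp h
    _ = ∫⁻ z, ∫⁻ ω, ‖∑ j ∈ F, (((a j : Lp ℝ 2 P) ω : ℝ) : ℂ) * e j z‖ₑ ^ q.toReal
          ∂P ∂(torusMeasure L) := lintegral_lintegral_swap hmeas.aemeasurable
    _ ≤ ∫⁻ _, B ^ q.toReal ∂(torusMeasure L) := lintegral_mono hpt
    _ = B ^ q.toReal := by simp

theorem memLp_ofReal_smul [IsProbabilityMeasure P] (hβ : IsIndepBrownianFamily P β)
    {E : Type*} [NormedAddCommGroup E] [NormedSpace ℂ E] {q : ℝ≥0∞} (hq : q ≠ ∞)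
    (a : gaussianSpace hβ) (v : E) :
    MemLp (fun ω => (((a : Lp ℝ 2 P) ω : ℝ) : ℂ) • v) q P := by
  have h1 : MemLp (a : Lp ℝ 2 P) q P :=
    ⟨Lp.aestronglyMeasurable _, (eLpNorm_le_of_mem_gaussianSpace hβ a.2 hq).trans_lt
      (ENNReal.mul_lt_top (gaussianMoment_ne_top hq).lt_top enorm_lt_top)⟩
  have h2 : MemLp (fun ω => (((a : Lp ℝ 2 P) ω : ℝ) : ℂ)) q P := h1.ofReal
  refine MemLp.of_le_mul (c := ‖v‖) h2 (h2.1.smul_const v) (Eventually.of_forall fun ω => ?_)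
  rw [norm_smul, mul_comm]

/-- The random vector `ω ↦ a(ω) v` in `L^q(Ω; E)`, for a Gaussian variable `a`. -/
def randomVector [IsProbabilityMeasure P] (hβ : IsIndepBrownianFamily P β)
    {E : Type*} [NormedAddCommGroup E] [NormedSpace ℂ E] {q : ℝ≥0∞} (hq : q ≠ ∞)
    (a : gaussianSpace hβ) (v : E) : Lp E q P :=
  (memLp_ofReal_smul hβ hq a v).toLp

theorem randomVector_sub [IsProbabilityMeasure P] (hβ : IsIndepBrownianFamily P β)
    {E : Type*} [NormedAddCommGroup E] [NormedSpace ℂ E] {q : ℝ≥0∞} (hq : q ≠ ∞)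
    (a b : gaussianSpace hβ) (v : E) :
    randomVector hβ hq (a - b) v = randomVector hβ hq a v - randomVector hβ hq b v := by
  unfold randomVector
  rw [← MemLp.toLp_sub]
  refine MemLp.toLp_congr _ _ ?_
  filter_upwards [Lp.coeFn_sub (a : Lp ℝ 2 P) (b : Lp ℝ 2 P)] with ω h
  rw [Pi.sub_apply, ← sub_smul, Submodule.coe_sub, h, Pi.sub_apply, Complex.ofReal_sub]

theorem coeFn_sum_randomVector [IsProbabilityMeasure P] (hβ : IsIndepBrownianFamily P β)
    {E : Type*} [NormedAddCommGroup E] [NormedSpace ℂ E] {q : ℝ≥0∞} (hq : q ≠ ∞)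
    (F : Finset (ℤ × ℤ)) (a : ℤ × ℤ → gaussianSpace hβ) (v : ℤ × ℤ → E) :
    ((∑ j ∈ F, randomVector hβ hq (a j) (v j) : Lp E q P) : Ω → E) =ᵐ[P]
      fun ω => ∑ j ∈ F, (((a j : Lp ℝ 2 P) ω : ℝ) : ℂ) • v j := by
  refine (Lp.coeFn_finsetSum F _).trans ?_
  have h2 : ∀ᵐ ω ∂P, ∀ j ∈ F, randomVector hβ hq (a j) (v j) ω =
      (((a j : Lp ℝ 2 P) ω : ℝ) : ℂ) • v j := by
    rw [Finset.eventually_all]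
    exact fun j _ => (memLp_ofReal_smul hβ hq (a j) (v j)).coeFn_toLp
  filter_upwards [h2] with ω h
  rw [Finset.sum_apply]
  exact Finset.sum_congr rfl h

/-- Convergence in `L^q(Ω; L^p(𝕋²))` of a series of orthogonal Gaussian variables times uniformly
bounded functions. -/
theorem summable_randomVector_toLp [IsProbabilityMeasure P] (hβ : IsIndepBrownianFamily P β)
    {p q : ℝ≥0∞} [Fact (1 ≤ p)] [Fact (1 ≤ q)] (hpq : p ≤ q) (hq : q ≠ ∞)
    {a : ℤ × ℤ → gaussianSpace hβ}
    (ha : ∀ i j, i ≠ j → inner ℝ (a i : Lp ℝ 2 P) (a j) = 0) {e : ℤ × ℤ → C(Torus L, ℂ)} {K : ℝ}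
    (hK : ∀ j z, ‖e j z‖ ≤ K) {x : ℤ × ℤ → ℝ} (hx : Summable x)
    (hax : ∀ j, ‖(a j : Lp ℝ 2 P)‖ ^ 2 ≤ x j) :
    (Summable fun j => randomVector hβ hq (a j)
      (ContinuousMap.toLp p (torusMeasure L) ℂ (e j))) ∧
    ‖∑' j, randomVector hβ hq (a j) (ContinuousMap.toLp p (torusMeasure L) ℂ (e j))‖ ≤
      2 * (gaussianMoment q).toReal * K * Real.sqrt (∑' j, x j) := by
  have hK0 : 0 ≤ K := (norm_nonneg _).trans (hK 0 0)
  refine summable_and_norm_tsum_le (fun j => (sq_nonneg _).trans (hax j)) hx (by positivity)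
    fun F => ?_
  rw [Lp.norm_def, eLpNorm_congr_ae (coeFn_sum_randomVector hβ hq F a _)]
  refine (ENNReal.toReal_mono ?_ (eLpNorm_sum_smul_toLp_le hβ hpq hq F ha hK)).trans ?_
  · exact ENNReal.mul_ne_top (ENNReal.mul_ne_top (by simp) (gaussianMoment_ne_top hq)) (by simp)
  · rw [ENNReal.toReal_mul, ENNReal.toReal_mul, ENNReal.toReal_ofReal (by positivity), mul_assoc _ K]
    simp only [ENNReal.toReal_ofNat]
    gcongr with j
    exact hax j

end RandomSeries

/-! ### Fourier coefficients of the eigenfunctions -/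

section Modes

variable (L : ℝ) [Fact (0 < 2 * L)]

theorem coeff_expMode_of_ne {i j : ℤ × ℤ} (hij : i ≠ j) : coeff L (expMode L i) j = 0 := by
  have h0 : ∀ m n : ℤ, m ≠ n → ∫ t : AddCircle (2 * L), (fourier (-m) t : ℂ) * fourier n t
      ∂AddCircle.haarAddCircle = 0 := fun m n hmn => by
    have h := congrFun (fourierCoeff_fourier (T := 2 * L) n) m
    rw [Pi.single_eq_of_ne hmn] at h
    exact h
  have h1 : coeff L (expMode L i) j = ∫ z : Torus L, (((2 * L : ℝ) : ℂ)⁻¹ *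
      ((fourier (-i.1) z.1 : ℂ) * fourier j.1 z.1)) * (((2 * L : ℝ) : ℂ)⁻¹ *
      ((fourier (-i.2) z.2 : ℂ) * fourier j.2 z.2)) ∂(torusMeasure L) := by
    refine integral_congr_ae (Eventually.of_forall fun z => ?_)
    simp only [expMode, ContinuousMap.coe_mk, map_mul, map_inv₀, Complex.conj_ofReal, fourier_neg,
      Complex.conj_conj]
    ring
  rw [h1, torusMeasure, integral_prod_mul (fun x : AddCircle (2 * L) => ((2 * L : ℝ) : ℂ)⁻¹ *
      ((fourier (-i.1) x : ℂ) * fourier j.1 x)) (fun y : AddCircle (2 * L) =>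
      ((2 * L : ℝ) : ℂ)⁻¹ * ((fourier (-i.2) y : ℂ) * fourier j.2 y)),
    integral_const_mul, integral_const_mul]
  rcases (not_and_or.mp fun h => hij (Prod.ext h.1 h.2)) with h | h
  · rw [h0 _ _ h]; simp
  · rw [h0 _ _ h]; simp

omit [Fact (0 < 2 * L)] in
theorem conj_expMode (j : ℤ × ℤ) (z : Torus L) :
    (starRingEnd ℂ) (expMode L j z) = expMode L (-j) z := by
  simp only [expMode, ContinuousMap.coe_mk, map_mul, map_inv₀, Complex.conj_ofReal, fourier_neg,
    Complex.conj_conj, Prod.fst_neg, Prod.snd_neg]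

omit [Fact (0 < 2 * L)] in
theorem eigenvalue_neg (ε : ℝ) (j : ℤ × ℤ) : eigenvalue L ε (-j) = eigenvalue L ε j := by
  simp [eigenvalue]

variable {L} {e : ℤ × ℤ → C(Torus L, ℂ)}

-- The indices `i` and `-i` share an eigenvalue, so this form lets complex and real modes be treated
-- together.
omit [Fact (0 < 2 * L)] in
theorem exists_mode_eq (he : e = expMode L ∨ e = trigMode L) (i : ℤ × ℤ) :
    ∃ a b : ℂ, ∀ z, e i z = a * expMode L i z + b * expMode L (-i) z := by
  rcases he with rfl | rfl
  · exact ⟨1, 0, fun z => by simp⟩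
  · by_cases h1 : i = 0
    · exact ⟨1, 0, fun z => by simp [trigMode, h1]⟩
    by_cases h2 : 0 < i.1 ∨ (i.1 = 0 ∧ 0 < i.2)
    · refine ⟨Real.sqrt 2 / 2, Real.sqrt 2 / 2, fun z => ?_⟩
      rw [← conj_expMode]
      simp only [trigMode, ContinuousMap.coe_mk, if_neg h1, if_pos h2]
      rw [Complex.ofReal_mul, Complex.re_eq_add_conj]
      ring
    · refine ⟨Real.sqrt 2 / (2 * Complex.I), -(Real.sqrt 2 / (2 * Complex.I)), fun z => ?_⟩
      rw [← conj_expMode]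
      simp only [trigMode, ContinuousMap.coe_mk, if_neg h1, if_neg h2]
      rw [Complex.ofReal_mul, Complex.im_eq_sub_conj]
      ring

theorem norm_mode_le (he : e = expMode L ∨ e = trigMode L) (j : ℤ × ℤ) (z : Torus L) :
    ‖e j z‖ ≤ Real.sqrt 2 * (2 * L)⁻¹ := by
  have hL : 0 < 2 * L := Fact.out
  have hs : 1 ≤ Real.sqrt 2 := Real.one_le_sqrt.mpr (by norm_num)
  have h0 : (2 * L)⁻¹ ≤ Real.sqrt 2 * (2 * L)⁻¹ := le_mul_of_one_le_left (by positivity) hs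
  have h1 := norm_expMode L j z
  rcases he with rfl | rfl
  · exact h1.trans_le h0
  · simp only [trigMode, ContinuousMap.coe_mk]
    split_ifs
    · exact h1.trans_le h0
    · rw [Complex.norm_real, norm_mul, Real.norm_eq_abs, Real.norm_eq_abs,
        abs_of_nonneg (Real.sqrt_nonneg 2), ← h1]
      gcongr
      exact Complex.abs_re_le_norm _
    · rw [Complex.norm_real, norm_mul, Real.norm_eq_abs, Real.norm_eq_abs,
        abs_of_nonneg (Real.sqrt_nonneg 2), ← h1]
      gcongr
      exact Complex.abs_im_le_norm _

/-- The Fourier coefficients of an eigenfunction are supported on its eigenspace. -/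
theorem coeff_mode_eq_zero (he : e = expMode L ∨ e = trigMode L) {ε : ℝ} {i j : ℤ × ℤ}
    (hij : eigenvalue L ε i ≠ eigenvalue L ε j) : coeff L (e i) j = 0 := by
  obtain ⟨a, b, hab⟩ := exists_mode_eq he i
  have hint : ∀ k, Integrable (fun z => expMode L k z * (starRingEnd ℂ) (expMode L j z))
      (torusMeasure L) := fun k => integrable_mul_conj_expMode L
    ((expMode L k).continuous.integrable_of_hasCompactSupport
      (HasCompactSupport.of_compactSpace _)) j
  have h1 : coeff L (e i) j = a * coeff L (expMode L i) j + b * coeff L (expMode L (-i)) j := by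
    unfold coeff
    rw [← integral_const_mul, ← integral_const_mul,
      ← integral_add ((hint i).const_mul a) ((hint (-i)).const_mul b)]
    refine integral_congr_ae (Eventually.of_forall fun z => ?_)
    simp only [hab]
    ring
  rw [h1, coeff_expMode_of_ne, coeff_expMode_of_ne, mul_zero, mul_zero, add_zero]
  · rintro rfl
    exact hij (eigenvalue_neg L ε i).symm
  · rintro rfl
    exact hij rfl

end Modes

/-! ### Fourier coefficients as continuous functionals, and the identification of `𝒲^{s,p}` with
`L^p`. -/

section Coefficients

variable (L : ℝ) [Fact (0 < 2 * L)] (p : ℝ≥0∞) [Fact (1 ≤ p)]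

theorem norm_coeff_le (f : Lp ℂ p (torusMeasure L)) (j : ℤ × ℤ) :
    ‖coeff L f j‖ ≤ (2 * L)⁻¹ * ‖f‖ := by
  have hL : 0 < 2 * L := Fact.out
  have hf : Integrable f (torusMeasure L) := (Lp.memLp f).integrable Fact.out
  have h1 : ‖coeff L f j‖ ≤ ∫ z, ‖f z‖ * (2 * L)⁻¹ ∂(torusMeasure L) := by
    refine (norm_integral_le_integral_norm _).trans_eq (integral_congr_ae ?_)
    exact Eventually.of_forall fun z => by
      simp only [norm_mul, RCLike.norm_conj, norm_expMode]
  rw [integral_mul_const] at h1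
  rw [mul_comm (2 * L)⁻¹ ‖f‖]
  refine h1.trans (mul_le_mul_of_nonneg_right ?_ (by positivity))
  rw [integral_norm_eq_lintegral_enorm hf.1, ← eLpNorm_one_eq_lintegral_enorm, Lp.norm_def]
  exact ENNReal.toReal_mono (Lp.eLpNorm_ne_top f)
    (eLpNorm_le_eLpNorm_of_exponent_le Fact.out hf.1)

/-- The Fourier coefficient of index `j` as a continuous linear functional on `L^p(𝕋²)`. -/
def coeffCLM (j : ℤ × ℤ) : Lp ℂ p (torusMeasure L) →L[ℂ] ℂ :=
  LinearMap.mkContinuous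
    ((LinearMap.proj j).comp (PeriodicDistribution.subtype.comp (lpToDistribution L p)))
    (2 * L)⁻¹ fun f => norm_coeff_le L p f j

theorem coeffCLM_apply (j : ℤ × ℤ) (f : Lp ℂ p (torusMeasure L)) :
    coeffCLM L p j f = coeff L f j := rfl

theorem coeffCLM_toLp (j : ℤ × ℤ) (f : C(Torus L, ℂ)) :
    coeffCLM L p j (ContinuousMap.toLp p (torusMeasure L) ℂ f) = coeff L f j := by
  rw [coeffCLM_apply]
  refine integral_congr_ae ?_
  filter_upwards [ContinuousMap.coeFn_toLp (p := p) (𝕜 := ℂ) (torusMeasure L) f] with z hz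
  rw [hz]

theorem distLpNorm_lpToDistribution (f : Lp ℂ p (torusMeasure L)) :
    distLpNorm L p (lpToDistribution L p f) = ‖f‖ₑ := by
  refine le_antisymm (iInf_le_of_le f (iInf_le_of_le rfl le_rfl)) (le_iInf₂ fun g hg => ?_)
  rw [lpToDistribution_injective L p hg]

namespace Sobolev

variable (s : ℝ)

/-- The element of `𝒲^{s,p}(𝕋²)` with `(1 - 𝓛₀)^{s/2} f = g`. -/
def ofLp (g : Lp ℂ p (torusMeasure L)) : Sobolev L s p :=
  ⟨besselPotential L (-s) (lpToDistribution L p g), g, by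
    ext j
    have h1 := one_le_one_sub_eigenvalue L j
    change _ = (((1 - eigenvalue L 0 j) ^ (s / 2) : ℝ) : ℂ) *
      ((((1 - eigenvalue L 0 j) ^ (-s / 2) : ℝ) : ℂ) * (lpToDistribution L p g : ℤ × ℤ → ℂ) j)
    rw [← mul_assoc, ← Complex.ofReal_mul, ← Real.rpow_add (by linarith),
      show s / 2 + -s / 2 = 0 by ring, Real.rpow_zero, Complex.ofReal_one, one_mul]⟩

theorem toLp_ofLp (g : Lp ℂ p (torusMeasure L)) : toLp L s p (ofLp L p s g) = g := by
  refine lpToDistribution_injective L p ?_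
  rw [toDistribution_toLp]
  ext j
  have h1 := one_le_one_sub_eigenvalue L j
  change (((1 - eigenvalue L 0 j) ^ (s / 2) : ℝ) : ℂ) *
      ((((1 - eigenvalue L 0 j) ^ (-s / 2) : ℝ) : ℂ) * (lpToDistribution L p g : ℤ × ℤ → ℂ) j) = _
  rw [← mul_assoc, ← Complex.ofReal_mul, ← Real.rpow_add (by linarith),
    show s / 2 + -s / 2 = 0 by ring, Real.rpow_zero, Complex.ofReal_one, one_mul]

theorem toDistribution_ofLp_apply (g : Lp ℂ p (torusMeasure L)) (j : ℤ × ℤ) :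
    (toDistribution L s p (ofLp L p s g) : ℤ × ℤ → ℂ) j =
      (((1 - eigenvalue L 0 j) ^ (-s / 2) : ℝ) : ℂ) * coeffCLM L p j g := rfl

theorem norm_ofLp_sub (f g : Lp ℂ p (torusMeasure L)) :
    ‖ofLp L p s f - ofLp L p s g‖ = ‖f - g‖ := by
  change ‖toLp L s p (ofLp L p s f - ofLp L p s g)‖ = _
  rw [map_sub, toLp_ofLp, toLp_ofLp]

theorem continuous_ofLp : Continuous (ofLp L p s) := by
  refine (Isometry.of_dist_eq fun f g => ?_).continuous
  rw [dist_eq_norm, dist_eq_norm, norm_ofLp_sub]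

end Sobolev

end Coefficients

/-! ### The stochastic convolution -/

section StochasticConvolution

variable {L : ℝ} {T : ℝ≥0} {Ω : Type*} [MeasurableSpace Ω] {P : Measure Ω}
  {β : ℤ × ℤ → ℝ≥0 → Ω → ℝ}

theorem convIntegrand_zero (lam : ℝ) : convIntegrand lam 0 = 0 := by
  simp [convIntegrand]; rfl

/-- The Wiener integrals of the stochastic convolution as elements of the Gaussian Hilbert space,
orthogonal for different modes, with a Hölder bound of the variance of their increments. -/
theorem exists_gaussianSpace_coefficients (hβ : IsIndepBrownianFamily P β)
    {I : ℝ≥0 → ℤ × ℤ → Ω → ℝ} (hI : ∀ t ≤ T, ∀ j, IsWienerIntegral P (β j) t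
      (fun u => Real.exp (((t : ℝ) - u) * eigenvalue L 1 j)) (I t j)) :
    ∃ W : ℝ≥0 → ℤ × ℤ → gaussianSpace hβ,
      (∀ t ≤ T, ∀ j, (W t j : Lp ℝ 2 P) =ᵐ[P] I t j) ∧
      (∀ s ≤ T, ∀ t ≤ T, ∀ i j, i ≠ j →
        inner ℝ ((W t i - W s i : gaussianSpace hβ) : Lp ℝ 2 P)
          ((W t j - W s j : gaussianSpace hβ) : Lp ℝ 2 P) = 0) ∧
      (∀ s ≤ T, ∀ t ≤ T, ∀ γ : ℝ, 0 ≤ γ → γ ≤ 1 → ∀ j,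
        ‖((W t j - W s j : gaussianSpace hβ) : Lp ℝ 2 P)‖ ^ 2 ≤
          2 * Real.exp (6 * T) * |(t : ℝ) - s| ^ γ * (1 - eigenvalue L 0 j) ^ (γ - 1)) ∧
      ∀ j, W 0 j = 0 := by
  have hex : ∀ t j, ∃ w : gaussianSpace hβ, t ≤ T →
      (∃ hf : MemLp (convIntegrand (eigenvalue L 1 j) t) 2 volume,
        (hf.toLp, (w : Lp ℝ 2 P)) ∈ wienerGraph hβ j) ∧ (w : Lp ℝ 2 P) =ᵐ[P] I t j := by
    intro t j
    by_cases ht : t ≤ T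
    · obtain ⟨hf, hIt, hmem⟩ := (hI t ht j).mem_wienerGraph hβ
      exact ⟨⟨hIt.toLp, snd_mem_gaussianSpace hβ hmem⟩, fun _ => ⟨⟨hf, hmem⟩, hIt.coeFn_toLp⟩⟩
    -- Times beyond `T` receive the default value `0`, so that a family indexed by all times can be
    -- chosen.
    · exact ⟨0, fun h => absurd h ht⟩
  choose W hW using hex
  refine ⟨W, fun t ht j => (hW t j ht).2, fun s hs t ht i j hij => ?_,
    fun s hs t ht γ h0 h1 j => ?_, fun j => ?_⟩
  · obtain ⟨_, h1⟩ := (hW t i ht).1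
    obtain ⟨_, h2⟩ := (hW s i hs).1
    obtain ⟨_, h3⟩ := (hW t j ht).1
    obtain ⟨_, h4⟩ := (hW s j hs).1
    exact inner_eq_zero_of_mem_wienerGraph hβ hij (Submodule.sub_mem _ h1 h2)
      (Submodule.sub_mem _ h3 h4)
  · wlog hst : s ≤ t generalizing s t
    · have := this t ht s hs (le_of_not_ge hst)
      rw [abs_sub_comm]
      rwa [Submodule.coe_sub, norm_sub_rev, ← Submodule.coe_sub] at this
    obtain ⟨hft, h3⟩ := (hW t j ht).1
    obtain ⟨hfs, h4⟩ := (hW s j hs).1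
    -- The isometry is applied to the difference of the pairs at times `t` and `s`, both lying in
    -- the same graph.
    have h5 := norm_eq_of_mem_wienerGraph hβ (Submodule.sub_mem _ h3 h4)
    have hμ := one_le_one_sub_eigenvalue L j
    have hl := eigenvalue_one L j
    have h6 := integral_sq_convIntegrand_sub_le (lam := eigenvalue L 1 j) (by linarith) h0 h1 hst ht
    rw [show 2 - eigenvalue L 1 j = 1 - eigenvalue L 0 j by rw [hl]; ring] at h6
    rw [abs_of_nonneg (sub_nonneg.mpr (NNReal.coe_le_coe.mpr hst))]
    refine le_trans (le_of_eq ?_) h6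
    rw [← norm_sq_toLp_sub hft hfs]
    exact congrArg (· ^ 2) h5
  · obtain ⟨hf, h⟩ := (hW 0 j zero_le).1
    have h1 := norm_eq_of_mem_wienerGraph hβ h
    have h2 : hf.toLp = 0 := by
      rw [Lp.eq_zero_iff_ae_eq_zero]
      refine hf.coeFn_toLp.trans ?_
      exact Eventually.of_forall fun u => congrFun (convIntegrand_zero _) u
    rw [h2, norm_zero, norm_eq_zero] at h1
    exact Subtype.ext h1

variable [Fact (0 < 2 * L)] [IsProbabilityMeasure P]

/-- The constant in the bound of the increments of `(1 - 𝓛₀)^{s/2} Z` in `L^q(Ω; L^p(𝕋²))`. -/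
def incrementConst (L : ℝ) (T : ℝ≥0) (q : ℝ≥0∞) (s γ : ℝ) : ℝ :=
  2 * (gaussianMoment q).toReal * (Real.sqrt 2 * (2 * L)⁻¹) *
    Real.sqrt (2 * Real.exp (6 * T) * ∑' j, (1 - eigenvalue L 0 j) ^ (-(1 - γ - s)))

/-- The process `(1 - 𝓛₀)^{s/2} Z` as a series in `L^q(Ω; L^p(𝕋²))`. -/
def convolutionSeries (hβ : IsIndepBrownianFamily P β) (p : ℝ≥0∞) [Fact (1 ≤ p)] {q : ℝ≥0∞}
    [Fact (1 ≤ q)] (hq : q ≠ ∞) (s : ℝ) (e : ℤ × ℤ → C(Torus L, ℂ))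
    (W : ℝ≥0 → ℤ × ℤ → gaussianSpace hβ) (t : ℝ≥0) : Lp (Lp ℂ p (torusMeasure L)) q P :=
  ∑' j, randomVector hβ hq (((1 - eigenvalue L 0 j) ^ (s / 2)) • W t j)
    (ContinuousMap.toLp p (torusMeasure L) ℂ (e j))

/-- With `μ = 1 - λ`, the weight turns the variance bound into `h^γ μ^s μ^(γ-1) = h^γ μ^(-(1-γ-s))`.
Its exponent passes the threshold `3/4` because `s + γ < 1/4`, and the square root of the sum leaves
`h^(γ/2)`. -/
theorem summable_convolution_increment (hβ : IsIndepBrownianFamily P β) {p : ℝ≥0∞} [Fact (1 ≤ p)]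
    {q : ℝ≥0∞} [Fact (1 ≤ q)] (hq : q ≠ ∞) (hpq : p ≤ q) {s γ : ℝ}
    (hsγ : s + γ < 1 / 4) {e : ℤ × ℤ → C(Torus L, ℂ)} (he : e = expMode L ∨ e = trigMode L)
    {w : ℤ × ℤ → gaussianSpace hβ} {h : ℝ} (hh : 0 ≤ h)
    (horth : ∀ i j, i ≠ j → inner ℝ (w i : Lp ℝ 2 P) (w j) = 0)
    (hw : ∀ j, ‖(w j : Lp ℝ 2 P)‖ ^ 2 ≤
      2 * Real.exp (6 * T) * h ^ γ * (1 - eigenvalue L 0 j) ^ (γ - 1)) :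
    (Summable fun j => randomVector hβ hq (((1 - eigenvalue L 0 j) ^ (s / 2)) • w j)
      (ContinuousMap.toLp p (torusMeasure L) ℂ (e j))) ∧
    ‖∑' j, randomVector hβ hq (((1 - eigenvalue L 0 j) ^ (s / 2)) • w j)
      (ContinuousMap.toLp p (torusMeasure L) ℂ (e j))‖ ≤
      incrementConst L T q s γ * h ^ (γ / 2) := by
  have hL : 0 < 2 * L := Fact.out
  have hsum := (summable_rpow_one_sub_eigenvalue (L := L) (by linarith)
    (r := 1 - γ - s) (by linarith)).mul_left (2 * Real.exp (6 * T) * h ^ γ)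
  have hmain := summable_randomVector_toLp hβ hpq hq
    (a := fun j => ((1 - eigenvalue L 0 j) ^ (s / 2)) • w j) (fun i j hij => by
      rw [Submodule.coe_smul, Submodule.coe_smul, real_inner_smul_left, real_inner_smul_right,
        horth i j hij, mul_zero, mul_zero])
    (fun j z => norm_mode_le he j z) hsum (fun j => by
      have hμ : 0 < 1 - eigenvalue L 0 j := by linarith [one_le_one_sub_eigenvalue L j]
      rw [Submodule.coe_smul, norm_smul, mul_pow, Real.norm_eq_abs, sq_abs, ← Real.rpow_natCast,
        ← Real.rpow_mul hμ.le]
      refine (mul_le_mul_of_nonneg_left (hw j) (by positivity)).trans_eq ?_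
      rw [mul_left_comm, ← Real.rpow_add hμ]
      congr 2
      push_cast; ring)
  refine ⟨hmain.1, hmain.2.trans_eq ?_⟩
  unfold incrementConst
  rw [tsum_mul_left, mul_right_comm _ (h ^ γ), Real.sqrt_mul' _ (Real.rpow_nonneg hh γ),
    Real.sqrt_eq_rpow (h ^ γ), ← Real.rpow_mul hh, mul_assoc _ _ (h ^ (γ / 2))]
  congr 3
  ring

variable {hβ : IsIndepBrownianFamily P β} {W : ℝ≥0 → ℤ × ℤ → gaussianSpace hβ}

theorem summable_convolutionSeries {p : ℝ≥0∞} [Fact (1 ≤ p)]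
    {q : ℝ≥0∞} [Fact (1 ≤ q)] (hq : q ≠ ∞) (hpq : p ≤ q) {s : ℝ} (hs : s < 1 / 4)
    {e : ℤ × ℤ → C(Torus L, ℂ)} (he : e = expMode L ∨ e = trigMode L)
    (horth : ∀ s ≤ T, ∀ t ≤ T, ∀ i j, i ≠ j →
        inner ℝ ((W t i - W s i : gaussianSpace hβ) : Lp ℝ 2 P)
          ((W t j - W s j : gaussianSpace hβ) : Lp ℝ 2 P) = 0)
    (hvar : ∀ s ≤ T, ∀ t ≤ T, ∀ γ : ℝ, 0 ≤ γ → γ ≤ 1 → ∀ j,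
        ‖((W t j - W s j : gaussianSpace hβ) : Lp ℝ 2 P)‖ ^ 2 ≤
          2 * Real.exp (6 * T) * |(t : ℝ) - s| ^ γ * (1 - eigenvalue L 0 j) ^ (γ - 1))
    (h0 : ∀ j, W 0 j = 0) {t : ℝ≥0} (ht : t ≤ T) :
    Summable fun j => randomVector hβ hq (((1 - eigenvalue L 0 j) ^ (s / 2)) • W t j)
      (ContinuousMap.toLp p (torusMeasure L) ℂ (e j)) := by
  -- The value at time `t` is the increment from time `0`, where `W` vanishes; `γ = 0` suffices for
  -- summability.
  have h1 := (summable_convolution_increment hβ hq hpq (s := s) (γ := 0) (by linarith) he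
    (abs_nonneg _) (horth 0 zero_le t ht) (hvar 0 zero_le t ht 0 le_rfl zero_le_one)).1
  simpa only [h0, sub_zero] using h1

theorem norm_convolutionSeries_sub_le {p : ℝ≥0∞} [Fact (1 ≤ p)]
    {q : ℝ≥0∞} [Fact (1 ≤ q)] (hq : q ≠ ∞) (hpq : p ≤ q) {s γ : ℝ} (hγ0 : 0 ≤ γ) (hγ1 : γ ≤ 1)
    (hsγ : s + γ < 1 / 4) {e : ℤ × ℤ → C(Torus L, ℂ)} (he : e = expMode L ∨ e = trigMode L)
    (horth : ∀ s ≤ T, ∀ t ≤ T, ∀ i j, i ≠ j →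
        inner ℝ ((W t i - W s i : gaussianSpace hβ) : Lp ℝ 2 P)
          ((W t j - W s j : gaussianSpace hβ) : Lp ℝ 2 P) = 0)
    (hvar : ∀ s ≤ T, ∀ t ≤ T, ∀ γ : ℝ, 0 ≤ γ → γ ≤ 1 → ∀ j,
        ‖((W t j - W s j : gaussianSpace hβ) : Lp ℝ 2 P)‖ ^ 2 ≤
          2 * Real.exp (6 * T) * |(t : ℝ) - s| ^ γ * (1 - eigenvalue L 0 j) ^ (γ - 1))
    (h0 : ∀ j, W 0 j = 0) {t t' : ℝ≥0} (ht : t ≤ T) (ht' : t' ≤ T) :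
    ‖convolutionSeries hβ p hq s e W t - convolutionSeries hβ p hq s e W t'‖ ≤
      incrementConst L T q s γ * |(t : ℝ) - t'| ^ (γ / 2) := by
  unfold convolutionSeries
  rw [← (summable_convolutionSeries hq hpq (by linarith) he horth hvar h0 ht).tsum_sub
    (summable_convolutionSeries hq hpq (by linarith) he horth hvar h0 ht')]
  simp_rw [← randomVector_sub, ← smul_sub]
  exact (summable_convolution_increment hβ hq hpq hsγ he (abs_nonneg _)
    (horth t' ht' t ht) (hvar t' ht' t ht γ hγ0 hγ1)).2

theorem convolutionSeries_zero {p : ℝ≥0∞} [Fact (1 ≤ p)]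
    {q : ℝ≥0∞} [Fact (1 ≤ q)] (hq : q ≠ ∞) (s : ℝ) (e : ℤ × ℤ → C(Torus L, ℂ))
    (h0 : ∀ j, W 0 j = 0) : convolutionSeries hβ p hq s e W 0 = 0 := by
  have h1 : ∀ v : Lp ℂ p (torusMeasure L), randomVector (q := q) hβ hq 0 v = 0 := fun v => by
    have := randomVector_sub hβ hq (0 : gaussianSpace hβ) 0 v
    rwa [sub_self, sub_self] at this
  unfold convolutionSeries
  simp only [h0, smul_zero, h1, tsum_zero]

/-- The Fourier coefficients of the series for `(1 - 𝓛₀)^{s/2} Z(t)`. -/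
theorem ae_coeffCLM_convolutionSeries {p : ℝ≥0∞} [Fact (1 ≤ p)]
    {q : ℝ≥0∞} [Fact (1 ≤ q)] (hq : q ≠ ∞) {s : ℝ} {e : ℤ × ℤ → C(Torus L, ℂ)}
    (he : e = expMode L ∨ e = trigMode L) {t : ℝ≥0}
    (hsum : Summable fun j => randomVector hβ hq (((1 - eigenvalue L 0 j) ^ (s / 2)) • W t j)
      (ContinuousMap.toLp p (torusMeasure L) ℂ (e j)))
    {Z : Ω → Lp ℂ 2 (torusMeasure L)} (hZ : AEStronglyMeasurable Z P)
    (hlim : Tendsto (fun F : Finset (ℤ × ℤ) => eLpNorm (fun ω => Z ω -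
      ∑ j ∈ F, (((W t j : Lp ℝ 2 P) ω : ℝ) : ℂ) •
        ContinuousMap.toLp 2 (torusMeasure L) ℂ (e j)) 2 P) atTop (𝓝 0)) :
    ∀ᵐ ω ∂P, ∀ j, coeffCLM L p j (convolutionSeries hβ p hq s e W t ω) =
      (((1 - eigenvalue L 0 j) ^ (s / 2) : ℝ) : ℂ) * coeffCLM L 2 j (Z ω) := by
  have hm1 : TendstoInMeasure P (fun F : Finset (ℤ × ℤ) => fun ω =>
      ∑ j ∈ F, (((W t j : Lp ℝ 2 P) ω : ℝ) : ℂ) •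
        ContinuousMap.toLp 2 (torusMeasure L) ℂ (e j)) atTop Z := by
    refine tendstoInMeasure_of_tendsto_eLpNorm (p := 2) (by simp) (fun F => ?_) hZ ?_
    · refine (Finset.stronglyMeasurable_fun_sum F fun j _ => ?_).aestronglyMeasurable
      exact (Complex.continuous_ofReal.comp_stronglyMeasurable
        (Lp.stronglyMeasurable (W t j : Lp ℝ 2 P))).smul_const _
    · refine hlim.congr fun F => ?_
      rw [← eLpNorm_sub_comm]; rfl
  have hm2 := tendstoInMeasure_of_tendsto_Lp hsum.hasSum
  -- Sums over finite sets form a net. A sequence of finite sets is extracted for convergence to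
  -- `Z`, then a subsequence for the weighted series, so both converge almost surely along the same
  -- sets.
  obtain ⟨F, hF, hF'⟩ := hm1.exists_seq_tendsto_ae'
  obtain ⟨ns, hns, hG⟩ := (hm2.comp hF).exists_seq_tendsto_ae
  have hae : ∀ᵐ ω ∂P, ∀ n, ((∑ j ∈ F n, randomVector hβ hq
      (((1 - eigenvalue L 0 j) ^ (s / 2)) • W t j) (ContinuousMap.toLp p (torusMeasure L) ℂ (e j)) :
      Lp (Lp ℂ p (torusMeasure L)) q P) : Ω → Lp ℂ p (torusMeasure L)) ω =
      ∑ j ∈ F n, ((((((1 - eigenvalue L 0 j) ^ (s / 2)) • W t j : gaussianSpace hβ) :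
        Lp ℝ 2 P) ω : ℝ) : ℂ) • ContinuousMap.toLp p (torusMeasure L) ℂ (e j) :=
    ae_all_iff.mpr fun n => coeFn_sum_randomVector hβ hq (F n) _ _
  have hae2 : ∀ᵐ ω ∂P, ∀ i, ((((1 - eigenvalue L 0 i) ^ (s / 2)) • W t i : gaussianSpace hβ) :
      Lp ℝ 2 P) ω = (1 - eigenvalue L 0 i) ^ (s / 2) * (W t i : Lp ℝ 2 P) ω :=
    ae_all_iff.mpr fun i => by
      filter_upwards [Lp.coeFn_smul ((1 - eigenvalue L 0 i) ^ (s / 2)) (W t i : Lp ℝ 2 P)]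
        with ω h
      rw [Submodule.coe_smul, h, Pi.smul_apply, smul_eq_mul]
  filter_upwards [hF', hG, hae, hae2] with ω h1 h2 h3 h4 j
  have h5 := ((coeffCLM L p j).continuous.tendsto _).comp h2
  have h6 := (((coeffCLM L 2 j).continuous.tendsto _).comp (h1.comp hns.tendsto_atTop)).const_mul
    (((1 - eigenvalue L 0 j) ^ (s / 2) : ℝ) : ℂ)
  refine tendsto_nhds_unique h5 (h6.congr fun n => ?_)
  simp only [Function.comp_apply, h3, h4, map_sum, map_smul, coeffCLM_toLp, Finset.mul_sum,
    smul_eq_mul]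
  refine Finset.sum_congr rfl fun i _ => ?_
  -- Mode `i` contributes to coefficient `j` only when the eigenvalues agree, so its weight can be
  -- replaced by that of `j`. For the real modes `i` need not equal `j`.
  by_cases hij : eigenvalue L 0 i = eigenvalue L 0 j
  · rw [hij]
    push_cast
    ring
  · rw [coeff_mode_eq_zero he hij, mul_zero, mul_zero, mul_zero]

/-- The general series estimate is used with `p = q = 2` and `s = 0`, where the weights equal `1`.
-/
theorem exists_isStochasticConvolution (hβ : IsIndepBrownianFamily P β) (T : ℝ≥0)
    {e : ℤ × ℤ → C(Torus L, ℂ)} (he : e = expMode L ∨ e = trigMode L) :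
    ∃ Z : ℝ≥0 → Ω → Lp ℂ 2 (torusMeasure L), IsStochasticConvolution L T P e β Z := by
  have hex : ∀ (t : ℝ≥0) (j : ℤ × ℤ), ∃ I : Ω → ℝ, IsWienerIntegral P (β j) t
      (fun u => Real.exp (((t : ℝ) - u) * eigenvalue L 1 j)) I := fun t j =>
    exists_isWienerIntegral hβ j t (by fun_prop)
  choose I hI using hex
  obtain ⟨W, hWI, horth, hvar, h0⟩ := exists_gaussianSpace_coefficients (L := L) (T := T) hβ
    fun t _ j => hI t j
  refine ⟨fun t => convolutionSeries hβ 2 (q := 2) ENNReal.ofNat_ne_top 0 e W t, fun t ht =>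
    ⟨Lp.aestronglyMeasurable _, I t, hI t, ?_⟩⟩
  have hs := (summable_convolutionSeries (p := 2) (q := 2) (s := 0) ENNReal.ofNat_ne_top le_rfl
    (by norm_num) he horth hvar h0 ht).hasSum
  have h1 := (Lp.tendsto_Lp_iff_tendsto_eLpNorm' _ _).mp hs
  refine h1.congr fun F => ?_
  rw [eLpNorm_sub_comm]
  refine eLpNorm_congr_ae ?_
  have hae : ∀ᵐ ω ∂P, ∀ j, (W t j : Lp ℝ 2 P) ω = I t j ω :=
    ae_all_iff.mpr fun j => hWI t ht j
  filter_upwards [coeFn_sum_randomVector hβ (q := 2) ENNReal.ofNat_ne_top F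
    (fun j => ((1 - eigenvalue L 0 j) ^ ((0 : ℝ) / 2)) • W t j)
    (fun j => ContinuousMap.toLp 2 (torusMeasure L) ℂ (e j)), hae] with ω h2 h3
  rw [Pi.sub_apply, h2]
  simp only [convolutionSeries, zero_div, Real.rpow_zero, one_smul, h3]

/-- A Hölder continuous modification of `(1 - 𝓛₀)^{s/2} Z` with values in `L^p(𝕋²)`. -/
theorem IsStochasticConvolution.exists_holder_modification (hβ : IsIndepBrownianFamily P β)
    (hT : 0 < T) {e : ℤ × ℤ → C(Torus L, ℂ)} (he : e = expMode L ∨ e = trigMode L)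
    {Z : ℝ≥0 → Ω → Lp ℂ 2 (torusMeasure L)} (hZ : IsStochasticConvolution L T P e β Z)
    {p : ℝ≥0∞} [Fact (1 ≤ p)] {q : ℝ≥0} (hpq : p ≤ q) {s γ α : ℝ} (hγ0 : 0 ≤ γ) (hγ1 : γ ≤ 1)
    (hsγ : s + γ < 1 / 4) (hα : 0 < α) (hαq : α * q + 1 < γ / 2 * q) :
    ∃ Y : ℝ≥0 → Ω → Lp ℂ p (torusMeasure L), (∀ t ≤ T, StronglyMeasurable (Y t)) ∧
      (∀ t ≤ T, ∀ᵐ ω ∂P, ∀ j, coeffCLM L p j (Y t ω) =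
        (((1 - eigenvalue L 0 j) ^ (s / 2) : ℝ) : ℂ) * coeffCLM L 2 j (Z t ω)) ∧
      (∀ ω, ∃ K : ℝ, ∀ t ≤ T, ∀ t' ≤ T, ‖Y t ω - Y t' ω‖ ≤ K * |(t : ℝ) - t'| ^ α) ∧
      ∃ N : Ω → ℝ≥0∞, (∀ᵐ ω ∂P, ∀ t ≤ T, ‖Y t ω‖ₑ ≤ N ω) ∧
        ∫⁻ ω, N ω ∂P ≤ ENNReal.ofReal (chainingConst α) * (1 +
          dyadicVariationBound (incrementConst L T q s γ ^ (q : ℝ)).toNNReal T α q (γ / 2 * q)) := by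
  have hp1 : 1 ≤ p := Fact.out
  have hq1 : (1 : ℝ≥0∞) ≤ q := hp1.trans hpq
  have : Fact (1 ≤ (q : ℝ≥0∞)) := ⟨hq1⟩
  have hq1' : (1 : ℝ) ≤ q := by exact_mod_cast hq1
  have hq0 : (0 : ℝ) < q := by linarith
  have hq : (q : ℝ≥0∞) ≠ ∞ := ENNReal.coe_ne_top
  have hZ' : ∀ t, ∃ I : ℤ × ℤ → Ω → ℝ, t ≤ T → (∀ j, IsWienerIntegral P (β j) t
      (fun u => Real.exp (((t : ℝ) - u) * eigenvalue L 1 j)) (I j)) ∧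
      Tendsto (fun F : Finset (ℤ × ℤ) => eLpNorm (fun ω => Z t ω -
        ∑ j ∈ F, ((I j ω : ℝ) : ℂ) • ContinuousMap.toLp 2 (torusMeasure L) ℂ (e j)) 2 P)
        atTop (𝓝 0) := by
    intro t
    by_cases ht : t ≤ T
    · obtain ⟨I, hI⟩ := (hZ t ht).2
      exact ⟨I, fun _ => hI⟩
    · exact ⟨0, fun h => absurd h ht⟩
  choose I hI using hZ'
  obtain ⟨W, hWI, horth, hvar, h0⟩ := exists_gaussianSpace_coefficients (L := L) (T := T) hβ
    fun t ht j => (hI t ht).1 j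
  have hB : 0 ≤ incrementConst L T q s γ := by
    have hL : 0 < 2 * L := Fact.out
    unfold incrementConst; positivity
  let V : ℝ≥0 → Ω → Lp ℂ p (torusMeasure L) := fun t => convolutionSeries hβ p hq s e W t
  have hVcoeff : ∀ t ≤ T, ∀ᵐ ω ∂P, ∀ j, coeffCLM L p j (V t ω) =
      (((1 - eigenvalue L 0 j) ^ (s / 2) : ℝ) : ℂ) * coeffCLM L 2 j (Z t ω) := by
    intro t ht
    refine ae_coeffCLM_convolutionSeries hq he (summable_convolutionSeries hq hpq (by linarith)
      he horth hvar h0 ht) (hZ t ht).1 ((hI t ht).2.congr fun F => ?_)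
    have hae : ∀ᵐ ω ∂P, ∀ j, (W t j : Lp ℝ 2 P) ω = I t j ω :=
      ae_all_iff.mpr fun j => hWI t ht j
    refine eLpNorm_congr_ae ?_
    filter_upwards [hae] with ω h
    simp only [h]
  have hVinc : ∀ t' ≤ T, ∀ t ≤ T, ∫⁻ ω, ‖V t ω - V t' ω‖ₑ ^ (q : ℝ) ∂P ≤
      ((incrementConst L T q s γ ^ (q : ℝ)).toNNReal : ℝ≥0∞) *
        ENNReal.ofReal (|(t : ℝ) - t'| ^ (γ / 2 * q)) := by
    intro t' ht' t ht
    have h1 := norm_convolutionSeries_sub_le hq hpq hγ0 hγ1 hsγ he horth hvar h0 ht ht'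
    have h2 := eLpNorm_congr_ae (p := (q : ℝ≥0∞)) (Lp.coeFn_sub
      (convolutionSeries hβ p hq s e W t) (convolutionSeries hβ p hq s e W t'))
    rw [← Lp.enorm_def, eLpNorm_eq_lintegral_rpow_enorm_toReal (by simpa using hq0.ne') hq,
      ENNReal.coe_toReal, one_div] at h2
    have h3 : ∫⁻ ω, ‖V t ω - V t' ω‖ₑ ^ (q : ℝ) ∂P =
        ‖convolutionSeries hβ p hq s e W t - convolutionSeries hβ p hq s e W t'‖ₑ ^ (q : ℝ) := by
      rw [h2, ENNReal.rpow_inv_rpow hq0.ne']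
      rfl
    rw [h3, ← ofReal_norm, ENNReal.ofReal_rpow_of_nonneg (norm_nonneg _) hq0.le]
    change _ ≤ ENNReal.ofReal (incrementConst L T q s γ ^ (q : ℝ)) * _
    rw [← ENNReal.ofReal_mul (by positivity)]
    refine ENNReal.ofReal_le_ofReal ((Real.rpow_le_rpow (norm_nonneg _) h1 hq0.le).trans_eq ?_)
    rw [Real.mul_rpow hB (by positivity), ← Real.rpow_mul (abs_nonneg _)]
  obtain ⟨Y, hYm, hYV, hYh, N, hN, hNint⟩ := SwiftHohenberg.exists_holder_modification (P := P)
    (V := V) (fun t => Lp.stronglyMeasurable _) hT hα hq1' hαq hVinc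
  refine ⟨Y, hYm, fun t ht => ?_, hYh, N, ?_, hNint⟩
  · filter_upwards [hVcoeff t ht, hYV t ht] with ω h1 h2 j
    rw [h2, h1]
  -- Since the process starts at zero, the bound of the oscillation from time `0` bounds the norm
  -- itself.
  · have hV0 : V 0 =ᵐ[P] 0 := by
      simp only [V, convolutionSeries_zero hq s e h0]
      exact Lp.coeFn_zero _ _ _
    filter_upwards [hV0, hYV 0 zero_le] with ω h1 h2 t ht
    have h3 := hN t ht ω
    rwa [h2, h1, Pi.zero_apply, sub_zero] at h3

end StochasticConvolution

/-! ### Consequences of path continuity: countable suprema and equality at all times. -/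

section Paths

theorem continuous_restrict_of_holder {E : Type*} [NormedAddCommGroup E] {T : ℝ≥0} {f : ℝ≥0 → E}
    {K α : ℝ} (hα : 0 < α)
    (h : ∀ t ≤ T, ∀ t' ≤ T, ‖f t - f t'‖ ≤ K * |(t : ℝ) - t'| ^ α) :
    Continuous fun t : Iic T => f t := by
  rw [continuous_iff_continuousAt]
  intro t
  rw [ContinuousAt, tendsto_iff_norm_sub_tendsto_zero]
  refine squeeze_zero (fun _ => norm_nonneg _) (fun u => h u u.2 t t.2) ?_
  have h1 : Tendsto (fun u : Iic T => |((u : ℝ≥0) : ℝ) - (t : ℝ≥0)|) (𝓝 t) (𝓝 0) := by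
    have : Continuous fun u : Iic T => |((u : ℝ≥0) : ℝ) - (t : ℝ≥0)| := by fun_prop
    simpa using this.tendsto t
  simpa [Real.zero_rpow hα.ne'] using (h1.rpow_const (p := α) (Or.inr hα.le)).const_mul K

/-- Path continuity reduces the supremum to a countable dense set of times. -/
theorem measurable_iSup_enorm {E : Type*} [NormedAddCommGroup E] {Ω : Type*} [MeasurableSpace Ω]
    {T : ℝ≥0} {Y : ℝ≥0 → Ω → E} (hY : ∀ t ≤ T, StronglyMeasurable (Y t))
    (hc : ∀ ω, Continuous fun t : Iic T => Y t ω) :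
    Measurable fun ω => ⨆ t ∈ Icc 0 T, ‖Y t ω‖ₑ := by
  obtain ⟨D, hD, hDd⟩ := TopologicalSpace.exists_countable_dense (Iic T)
  have h1 : (fun ω => ⨆ t ∈ Icc 0 T, ‖Y t ω‖ₑ) =
      fun ω => ⨆ d : D, ‖Y (d : Iic T) ω‖ₑ := by
    ext ω
    rw [hDd.ciSup' (f := fun t : Iic T => ‖Y t ω‖ₑ) (continuous_enorm.comp (hc ω)), iSup_subtype]
    simp
  rw [h1]
  have := hD.to_subtype
  exact Measurable.iSup fun d => (hY _ (d : Iic T).2).enorm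

/-- Two processes with continuous paths whose values agree almost surely at each time agree
almost surely at all times. -/
theorem ae_forall_eq_of_continuous {E : Type*} [TopologicalSpace E] [T2Space E] {Ω : Type*}
    [MeasurableSpace Ω] {P : Measure Ω} {T : ℝ≥0} {X Y : ℝ≥0 → Ω → E}
    (hX : ∀ ω, Continuous fun t : Iic T => X t ω) (hY : ∀ ω, Continuous fun t : Iic T => Y t ω)
    (h : ∀ t ≤ T, ∀ᵐ ω ∂P, X t ω = Y t ω) : ∀ᵐ ω ∂P, ∀ t ≤ T, X t ω = Y t ω := by
  obtain ⟨D, hD, hDd⟩ := TopologicalSpace.exists_countable_dense (Iic T)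
  have h1 : ∀ᵐ ω ∂P, ∀ d ∈ D, X d ω = Y d ω := (ae_ball_iff hD).mpr fun d _ => h d d.2
  filter_upwards [h1] with ω h2 t ht
  exact congrFun ((hX ω).ext_on hDd (hY ω) h2) ⟨t, ht⟩

theorem rpow_neg_half_mul_rpow_half {x : ℝ} (hx : 0 < x) (s : ℝ) :
    ((x ^ (-s / 2) : ℝ) : ℂ) * ((x ^ (s / 2) : ℝ) : ℂ) = 1 := by
  rw [← Complex.ofReal_mul, ← Real.rpow_add hx, show -s / 2 + s / 2 = 0 by ring, Real.rpow_zero,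
    Complex.ofReal_one]

end Paths

end SwiftHohenberg

end

/-! ### The main theorem: choice of exponents and comparison of two modifications. -/

theorem mainTheorem1 (L : ℝ) [Fact (0 < 2 * L)] (T : ℝ≥0) (hT : 0 < T)
    (p : ℝ≥0∞) [Fact (1 ≤ p)] (hp : p ≠ ∞) :
    ∃ M : ℝ≥0, 0 < M ∧
      ∀ (Ω : Type*) [MeasurableSpace Ω] (P : Measure Ω) [IsProbabilityMeasure P]
        (e : ℤ × ℤ → C(Torus L, ℂ)) (_ : e = expMode L ∨ e = trigMode L)
        (β : ℤ × ℤ → ℝ≥0 → Ω → ℝ) (_ : IsIndepBrownianFamily P β),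
        (∃ Z : ℝ≥0 → Ω → Lp ℂ 2 (torusMeasure L), IsStochasticConvolution L T P e β Z) ∧
        ∀ Z : ℝ≥0 → Ω → Lp ℂ 2 (torusMeasure L), IsStochasticConvolution L T P e β Z →
          ∀ s α : ℝ, 0 ≤ s → s < 1 / 8 → 0 < α → α < 1 / 8 - s →
            ∃ Y : ℝ≥0 → Ω → Sobolev L s p,
              (∀ t ≤ T, StronglyMeasurable (Y t)) ∧
              (∀ t ≤ T, ∀ᵐ ω ∂P, Sobolev.toDistribution L s p (Y t ω) =
                lpToDistribution L 2 (Z t ω)) ∧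
              (∀ ω, ∃ C : ℝ, ∀ t ≤ T, ∀ t' ≤ T,
                ‖Y t ω - Y t' ω‖ ≤ C * |(t : ℝ) - (t' : ℝ)| ^ α) ∧
              AEMeasurable
                (fun ω => ⨆ t ∈ Icc 0 T, distLpNorm L p (Sobolev.toDistribution L s p (Y t ω))) P ∧
              ∫⁻ ω, ⨆ t ∈ Icc 0 T, distLpNorm L p (Sobolev.toDistribution L s p (Y t ω)) ∂P ≤ M := by
  have hp0 : p ≤ (p.toNNReal : ℝ≥0∞) := (ENNReal.coe_toNNReal hp).ge
  -- For the mean bound the exponents are fixed as `s = 0`, `α = 1/16`, `γ = 3/16`. Kolmogorov's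
  -- condition `q/16 + 1 < 3q/32` then means `q > 32`. The resulting constant involves only `p`, `T`
  -- and `L`.
  set q₀ : ℝ≥0 := max p.toNNReal 33 with hq₀
  have hpq₀ : p ≤ q₀ := hp0.trans (by exact_mod_cast le_max_left _ _)
  have hq₀' : (33 : ℝ) ≤ q₀ := by exact_mod_cast le_max_right p.toNNReal 33
  set b₀ := ENNReal.ofReal (chainingConst (1 / 16)) * (1 + dyadicVariationBound
    (incrementConst L T q₀ 0 (3 / 16) ^ (q₀ : ℝ)).toNNReal T (1 / 16) q₀ (3 / 16 / 2 * q₀)) with hb₀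
  have hb₀' : b₀ ≠ ∞ := ENNReal.mul_ne_top (by simp) (ENNReal.add_ne_top.mpr
    ⟨by simp, dyadicVariationBound_ne_top _ _ (by linarith)⟩)
  refine ⟨b₀.toNNReal + 1, by positivity, fun Ω _ P _ e he β hβ =>
    ⟨exists_isStochasticConvolution hβ T he, fun Z hZ s α hs0 _ hα hαs => ?_⟩⟩
  -- There is room for `γ` because `2α < 1/4 - 2s ≤ 1/4 - s`; then any `q > 1/(γ/2 - α)` satisfies
  -- Kolmogorov's condition.
  obtain ⟨γ, hαγ, hγs⟩ : ∃ γ, 2 * α < γ ∧ γ < 1 / 4 - s := exists_between (by linarith)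
  obtain ⟨q₁, hq₁⟩ := exists_nat_gt (1 / (γ / 2 - α))
  rw [div_lt_iff₀ (by linarith)] at hq₁
  set q : ℝ≥0 := max p.toNNReal q₁ with hq
  have hpq : p ≤ q := hp0.trans (by exact_mod_cast le_max_left _ _)
  have hq' : (q₁ : ℝ) ≤ q := by exact_mod_cast le_max_right p.toNNReal (q₁ : ℝ≥0)
  have hαq : α * q + 1 < γ / 2 * q := by nlinarith
  obtain ⟨Y, hYm, hYc, hYh, -⟩ := hZ.exists_holder_modification hβ hT he hpq (s := s)
    (by linarith) (by linarith) (by linarith) hα hαq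
  obtain ⟨X, hXm, hXc, hXh, N, hN, hNint⟩ := hZ.exists_holder_modification hβ hT he hpq₀
    (s := 0) (γ := 3 / 16) (α := 1 / 16) (by norm_num) (by norm_num) (by norm_num) (by norm_num)
    (by linarith)
  have hμ : ∀ j, 0 < 1 - eigenvalue L 0 j := fun j => by linarith [one_le_one_sub_eigenvalue L j]
  have hYcont : ∀ ω, Continuous fun t : Iic T => Y t ω := fun ω =>
    (hYh ω).elim fun _ h => continuous_restrict_of_holder hα h
  have hXcont : ∀ ω, Continuous fun t : Iic T => X t ω := fun ω =>
    (hXh ω).elim fun _ h => continuous_restrict_of_holder (by norm_num) h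
  -- Undoing the weight on the coefficients of `Y` gives those of `Z`, which are also those of `X`.
  -- Continuity in time puts all `t` into one null set, so the `L^p`-norm of the `𝒲^{s,p}`-valued
  -- modification equals that of `X` and inherits its mean bound.
  have hYX : ∀ᵐ ω ∂P, ∀ t ≤ T,
      distLpNorm L p (Sobolev.toDistribution L s p (Sobolev.ofLp L p s (Y t ω))) = ‖X t ω‖ₑ := by
    have h1 : ∀ᵐ ω ∂P, ∀ j, ∀ t ≤ T, (((1 - eigenvalue L 0 j) ^ (-s / 2) : ℝ) : ℂ) *
        coeffCLM L p j (Y t ω) = coeffCLM L p j (X t ω) := by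
      refine ae_all_iff.mpr fun j => ae_forall_eq_of_continuous
        (X := fun t ω => (((1 - eigenvalue L 0 j) ^ (-s / 2) : ℝ) : ℂ) * coeffCLM L p j (Y t ω))
        (Y := fun t ω => coeffCLM L p j (X t ω))
        (fun ω => continuous_const.mul ((coeffCLM L p j).continuous.comp (hYcont ω)))
        (fun ω => (coeffCLM L p j).continuous.comp (hXcont ω)) fun t ht => ?_
      filter_upwards [hYc t ht, hXc t ht] with ω h2 h3
      rw [h2, h3, ← mul_assoc, rpow_neg_half_mul_rpow_half (hμ j), zero_div, Real.rpow_zero,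
        Complex.ofReal_one]
    filter_upwards [h1] with ω h2 t ht
    rw [← distLpNorm_lpToDistribution]
    congr 1
    exact Subtype.ext (funext fun j => h2 j t ht)
  have hsup : (fun ω => ⨆ t ∈ Icc 0 T, distLpNorm L p
      (Sobolev.toDistribution L s p (Sobolev.ofLp L p s (Y t ω)))) =ᵐ[P]
      fun ω => ⨆ t ∈ Icc 0 T, ‖X t ω‖ₑ := by
    filter_upwards [hYX] with ω h
    exact iSup_congr fun t => iSup_congr fun ht => h t ht.2
  refine ⟨fun t ω => Sobolev.ofLp L p s (Y t ω), fun t ht =>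
    (Sobolev.continuous_ofLp L p s).comp_stronglyMeasurable (hYm t ht), fun t ht => ?_,
    fun ω => ?_, (measurable_iSup_enorm hXm hXcont).aemeasurable.congr hsup.symm, ?_⟩
  · filter_upwards [hYc t ht] with ω h
    refine Subtype.ext (funext fun j => ?_)
    rw [Sobolev.toDistribution_ofLp_apply, h j, ← mul_assoc, rpow_neg_half_mul_rpow_half (hμ j),
      one_mul]
    rfl
  · obtain ⟨K, hK⟩ := hYh ω
    exact ⟨K, fun t ht t' ht' => (Sobolev.norm_ofLp_sub L p s _ _).trans_le (hK t ht t' ht')⟩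
  · rw [lintegral_congr_ae hsup]
    refine le_trans (lintegral_mono_ae (g := N) ?_) (hNint.trans ?_)
    · filter_upwards [hN] with ω h
      exact iSup₂_le fun t ht => h t ht.2
    · rw [ENNReal.coe_add, ENNReal.coe_toNNReal hb₀']
      exact le_self_add
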